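/- **Setting.** For $n\ge 0$ write $[n]=\{1,\dots,n\}$ and $[n]_0=\{0,1,\dots,n\}$, and $B^+=B\setminus\{0\}$ for $B\subseteq[n]_0$. A *partial set supercomposition* $K=(K_1,\dots,K_q)$ of bidegree $(n,m)$, $m\le n+1$, is a tuple of nonempty subsets (blocks) of $[n]_0$ such that $(K_1\cup\dots\cup K_q)^+=[n]$, $K_i\cap K_j\subseteq\{0\}$ for $i\ne j$, exactly $K_1,\dots,K_m$ contain $0$ (the *fermionic* blocks), and the other blocks are ordered by increasing minima. $K^+$ is the set partition of $[n]$ formed by the nonempty $K_i^+$. A *set superpartition* is a partial set supercomposition $I$ with $I_i\neq I_j$ and $\min(I_i\setminus I_j)<\min(I_j\setminus I_i)$ for $i<j$, where $\min\emptyset:=0$. Write $K\sqsubseteq L$ if, for each $i\in[m]$, $L_i$ is $K_i$ joined with some (possibly no) nonfermionic blocks of $K$, and each nonfermionic block of $L$ is a union of nonfermionic blocks of $K$. The meet $K\sqcap L$ for $\sqsubseteq$ has $i$-th fermionic block $K_i\cap L_i$, and its nonfermionic blocks are those of the meet of the set partitions obtained from $K^+$ and $L^+$ by removing the elements of $A=\bigcup_{i\le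 m}(K_i\cap L_i)$. Put $K!=\prod_i|K_i|!$ (the element $0$ is counted). *Noncommuting variables.* Consider formal power series over $\mathbb Q$ of bounded degree in variables $x_1,x_2,\dots$ and $\theta_1,\theta_2,\dots$, where $x_i\theta_j=\theta_jx_i$, $\theta_i\theta_j=-\theta_j\theta_i$, and the $x_i$ do not commute with each other. For $K$ of bidegree $(n,m)$, each of $m_K,p_K,e_K$ is the sum of $\theta_{a_1}\cdots\theta_{a_m}x_{b_1}\cdots x_{b_n}$ over all tuples $(a_1,\dots,a_m,b_1,\dots,b_n)$ of positive integers such that, respectively: - $m_K$: for $i\in[m]$, $j\in[n]$, $a_i=b_j$ iff $j\in K_i^+$; and for $i,j\in[n]$, $b_i=b_j$ iff $i,j$ are in the same block of $K$; - $p_K$: $a_i=b_j$ whenever $j\in K_i^+$; and $b_i=b_j$ whenever $i,j$ are in the same block of $K$; - $e_K$: $a_i\ne b_j$ whenever $j\in K_i^+$; and $b_i\neq b_j$ whenever $i\ne j$ are in the same block of $K$. Finally $h_K=\sum_u c_u\,u$, over the monomials $u=\theta_{a_1}\cdots\theta_{a_m}x_{b_1}\cdots x_{b_n}$ (with pairwise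 distinct $a_i$) for which $\{a_1,\dots,a_m\}\setminus\{b_1,\dots,b_n\}$ has at most one element; here $c_u=(K\sqcap L)!$, where $L$ is the unique partial set supercomposition of bidegree $(n,m)$ such that $(a,b)$ is one of the tuples in the definition of $m_L$. *Commuting variables.* $\rho$ is the projection onto the formal power series of bounded degree in commuting $x_i$ and anticommuting $\theta_i$ that lets the $x_i$ commute with each other (each monomial is sent to the monomial in the same variables, and coefficients are added up). A *superpartition* $\Lambda=(\Lambda_1,\dots,\Lambda_m;\Lambda_{m+1},\dots,\Lambda_k)$ of bidegree $(n,m)$ consists of integers $\Lambda_1>\dots>\Lambda_m\ge0$ (this part is $\Lambda^a$) and $\Lambda_{m+1}\ge\dots\ge\Lambda_k\ge1$ (this part is $\Lambda^s$) with total sum $n$. Put $\Lambda!=\prod_i\Lambda_i!$ and $(\Lambda^s)^!=\prod_{r\ge1}k_r!$, where $k_r$ is the multiplicity of $r$ in $\Lambda^s$. Let $m_\Lambda$ be the sum of all different terms $\theta_{i_1}\cdots\theta_{i_m}x_{i_1}^{\Lambda_1}\cdots x_{i_k}^{\Lambda_k}$ with $i_1,\dots,i_k$ pairwise distinct, and for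 $b\in\{p,e,h\}$ let $b_\Lambda=\tilde b_{\Lambda_1}\cdots\tilde b_{\Lambda_m}b_{\Lambda_{m+1}}\cdots b_{\Lambda_k}$, where for $k\ge0$, $r\ge1$ $$\tilde p_k=\sum_i\theta_ix_i^k,\quad p_r=\sum_ix_i^r,\quad \tilde e_k=m_{(0;1^k)},\quad e_r=m_{(\emptyset;1^r)},$$ $$\tilde h_k=\sum_{\Lambda\text{ of bidegree }(k,1)}(\Lambda_1+1)\,m_\Lambda,\quad h_r=\sum_{\Lambda\text{ of bidegree }(r,0)}m_\Lambda .$$ For a set superpartition $I=(I_1,\dots,I_k)$ of bidegree $(n,m)$ whose fermionic blocks have pairwise different sizes, let $\Lambda(I)$ be the superpartition obtained from $(|I_1|-1,\dots,|I_m|-1;|I_{m+1}|,\dots,|I_k|)$ by sorting each of the two parts in decreasing order, and let $\varepsilon(I)$ be the minimal number of transpositions needed to obtain $\Lambda(I)^a$ from $(|I_1|-1,\dots,|I_m|-1)$. **Proposition.** Let $I$ be a set superpartition. If the fermionic blocks of $I$ have pairwise different sizes, then 1. $\rho(m_I)=(-1)^{\varepsilon(I)}\,(\Lambda(I)^s)^!\,m_{\Lambda(I)}$;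 2. $\rho(p_I)=(-1)^{\varepsilon(I)}\,p_{\Lambda(I)}$; 3. $\rho(e_I)=(-1)^{\varepsilon(I)}\,\Lambda(I)!\,e_{\Lambda(I)}$; 4. $\rho(h_I)=(-1)^{\varepsilon(I)}\,\Lambda(I)!\,h_{\Lambda(I)}$. If $I$ has two different fermionic blocks of the same size, then $\rho(m_I)=\rho(p_I)=\rho(e_I)=\rho(h_I)=0$. -/

import Mathlib

open Finset

noncomputable section

namespace Superspace

/-! ### Partial set supercompositions and set superpartitions -/

/-- A partial set supercomposition `K` of bidegree `(n, m)`. The element `j + 1` of `[n]` is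
represented by `j : Fin n`, and the extra symbol `0` is left implicit: the `i`-th fermionic block
is `K_i = {0} ∪ K_i⁺` with `K_i⁺ = ferm i`, and it may be `{0}`. The nonfermionic blocks (those
that do not contain `0`) are listed in a tuple by increasing minima, so that they form a set
`bos`. -/
@[ext]
structure SetSupercomp (n m : ℕ) where
  ferm : Fin m → Finset (Fin n)
  bos : Finset (Finset (Fin n))
  bos_nonempty : ∀ B ∈ bos, B.Nonempty
  ferm_disjoint : ∀ i j, i ≠ j → Disjoint (ferm i) (ferm j)
  bos_disjoint : ∀ B ∈ bos, ∀ C ∈ bos, B ≠ C → Disjoint B C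
  ferm_bos_disjoint : ∀ i, ∀ B ∈ bos, Disjoint (ferm i) B
  cover : ∀ x, (∃ i, x ∈ ferm i) ∨ ∃ B ∈ bos, x ∈ B
  df_le : m ≤ n + 1

namespace SetSupercomp

variable {n m : ℕ}

/-- The blocks of the underlying set partition `K⁺` of `[n]`. -/
def under (K : SetSupercomp n m) : Finset (Finset (Fin n)) :=
  (univ.image K.ferm).erase ∅ ∪ K.bos

/-- `i, j ∈ [n]` belong to the same block of `K`. -/
def SameBlock (K : SetSupercomp n m) (i j : Fin n) : Prop :=
  (∃ t, i ∈ K.ferm t ∧ j ∈ K.ferm t) ∨ ∃ B ∈ K.bos, i ∈ B ∧ j ∈ B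

/-- `K ⊑ L`, that is, `L` is strongly coarser than `K`: the `i`-th fermionic block of `L` is the
one of `K` joined with some nonfermionic blocks of `K`, and each nonfermionic block of `L` is a
union of nonfermionic blocks of `K`. -/
def StronglyFiner (K L : SetSupercomp n m) : Prop :=
  (∀ i, ∃ s ⊆ K.bos, L.ferm i = K.ferm i ∪ s.biUnion id) ∧
    ∀ B ∈ L.bos, ∃ s ⊆ K.bos, B = s.biUnion id

/-- The union of the sets `K_i ∩ L_i` with `i ∈ [m]` (without `0`). -/
def commonFerm (K L : SetSupercomp n m) : Finset (Fin n) :=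
  univ.biUnion fun i => K.ferm i ∩ L.ferm i

theorem mem_commonFerm {K L : SetSupercomp n m} {x : Fin n} :
    x ∈ commonFerm K L ↔ ∃ i, x ∈ K.ferm i ∧ x ∈ L.ferm i := by
  simp [commonFerm]

theorem under_cover (K : SetSupercomp n m) (x : Fin n) : ∃ B ∈ K.under, x ∈ B := by
  rcases K.cover x with ⟨i, hi⟩ | ⟨B, hB, hx⟩
  · refine ⟨K.ferm i, ?_, hi⟩
    simp only [under, mem_union, mem_erase, mem_image, mem_univ, true_and]
    exact Or.inl ⟨Finset.ne_empty_of_mem hi, i, rfl⟩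
  · exact ⟨B, by simp [under, hB], hx⟩

theorem under_unique (K : SetSupercomp n m) {B C : Finset (Fin n)} (hB : B ∈ K.under)
    (hC : C ∈ K.under) {x : Fin n} (hxB : x ∈ B) (hxC : x ∈ C) : B = C := by
  simp only [under, mem_union, mem_erase, mem_image, mem_univ, true_and] at hB hC
  rcases hB with ⟨_, i, rfl⟩ | hB <;> rcases hC with ⟨_, j, rfl⟩ | hC
  · by_cases h : i = j
    · rw [h]
    · exact absurd hxC (Finset.disjoint_left.1 (K.ferm_disjoint i j h) hxB)
  · exact absurd hxC (Finset.disjoint_left.1 (K.ferm_bos_disjoint i C hC) hxB)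
  · exact absurd hxB (Finset.disjoint_left.1 (K.ferm_bos_disjoint j B hB) hxC)
  · by_contra h
    exact absurd hxC (Finset.disjoint_left.1 (K.bos_disjoint B hB C hC h) hxB)

/-- The meet `K ⊓ L` for the relation `⊑`: its `i`-th fermionic block is `K_i ∩ L_i`, and its
nonfermionic blocks are those of the meet of the set partitions `K⁺ \ A` and `L⁺ \ A`, where `A`
is the union of the `K_i ∩ L_i`. -/
def meet (K L : SetSupercomp n m) : SetSupercomp n m where
  ferm i := K.ferm i ∩ L.ferm i
  bos := ((K.under ×ˢ L.under).image fun p =>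
    (p.1 \ commonFerm K L) ∩ (p.2 \ commonFerm K L)).erase ∅
  bos_nonempty B hB := Finset.nonempty_iff_ne_empty.2 (Finset.ne_of_mem_erase hB)
  ferm_disjoint i j h :=
    (K.ferm_disjoint i j h).mono Finset.inter_subset_left Finset.inter_subset_left
  bos_disjoint B hB C hC h := by
    simp only [mem_erase, mem_image, mem_product, Prod.exists] at hB hC
    obtain ⟨_, B₁, B₂, ⟨h1, h2⟩, rfl⟩ := hB
    obtain ⟨_, C₁, C₂, ⟨h3, h4⟩, rfl⟩ := hC
    rw [Finset.disjoint_left]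
    intro x hx hy
    simp only [mem_inter, mem_sdiff] at hx hy
    apply h
    rw [K.under_unique h1 h3 hx.1.1 hy.1.1, L.under_unique h2 h4 hx.2.1 hy.2.1]
  ferm_bos_disjoint i B hB := by
    simp only [mem_erase, mem_image, mem_product, Prod.exists] at hB
    obtain ⟨_, B₁, B₂, ⟨h1, h2⟩, rfl⟩ := hB
    rw [Finset.disjoint_left]
    intro x hx hy
    simp only [mem_inter, mem_sdiff] at hx hy
    exact hy.1.2 (mem_commonFerm.2 ⟨i, hx⟩)
  cover x := by
    by_cases hx : x ∈ commonFerm K L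
    · obtain ⟨i, hi⟩ := mem_commonFerm.1 hx
      exact Or.inl ⟨i, mem_inter.2 hi⟩
    · right
      obtain ⟨B, hB, hxB⟩ := K.under_cover x
      obtain ⟨C, hC, hxC⟩ := L.under_cover x
      have hmem : x ∈ (B \ commonFerm K L) ∩ (C \ commonFerm K L) := by
        simp [hxB, hxC, hx]
      refine ⟨_, Finset.mem_erase.2 ⟨Finset.ne_empty_of_mem hmem,
        Finset.mem_image.2 ⟨(B, C), Finset.mem_product.2 ⟨hB, hC⟩, rfl⟩⟩, hmem⟩
  df_le := K.df_le

theorem stronglyFiner_iff {K L : SetSupercomp n m} :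
    K.StronglyFiner L ↔ (∀ i, K.ferm i ⊆ L.ferm i) ∧
      ∀ E ∈ K.bos, (∃ i, E ⊆ L.ferm i) ∨ ∃ B ∈ L.bos, E ⊆ B := by
  constructor
  · rintro ⟨h1, h2⟩
    refine ⟨fun i => ?_, fun E hE => ?_⟩
    · obtain ⟨s, _, hs⟩ := h1 i
      rw [hs]
      exact Finset.subset_union_left
    · obtain ⟨x, hx⟩ := K.bos_nonempty E hE
      have key : ∀ s ⊆ K.bos, x ∈ s.biUnion id → E ⊆ s.biUnion id := by
        intro s hs hxs
        obtain ⟨E', hE', hx'⟩ := Finset.mem_biUnion.1 hxs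
        have : E = E' := K.under_unique (by simp [under, hE]) (by simp [under, hs hE']) hx hx'
        rw [this]
        exact Finset.subset_biUnion_of_mem id hE'
      rcases L.cover x with ⟨i, hi⟩ | ⟨B, hB, hxB⟩
      · left
        refine ⟨i, ?_⟩
        obtain ⟨s, hs, he⟩ := h1 i
        rw [he] at hi ⊢
        rcases Finset.mem_union.1 hi with h | h
        · exact absurd hx (Finset.disjoint_left.1 (K.ferm_bos_disjoint i E hE) h)
        · exact (key s hs h).trans Finset.subset_union_right
      · right
        refine ⟨B, hB, ?_⟩
        obtain ⟨s, hs, he⟩ := h2 B hB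
        rw [he] at hxB ⊢
        exact key s hs hxB
  · rintro ⟨h1, h2⟩
    have key : ∀ E ∈ K.bos, ∀ x ∈ E, ∀ B ∈ L.under, x ∈ B → E ⊆ B := by
      intro E hE x hx B hB hxB
      rcases h2 E hE with ⟨i, hi⟩ | ⟨C, hC, hEC⟩
      · have : B = L.ferm i := L.under_unique hB (by
          simp only [under, mem_union, mem_erase, mem_image, mem_univ, true_and]
          exact Or.inl ⟨Finset.ne_empty_of_mem (hi hx), i, rfl⟩) hxB (hi hx)
        rwa [this]
      · have : B = C := L.under_unique hB (by simp [under, hC]) hxB (hEC hx)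
        rwa [this]
    refine ⟨fun i => ⟨K.bos.filter (· ⊆ L.ferm i), Finset.filter_subset _ _, ?_⟩,
      fun B hB => ⟨K.bos.filter (· ⊆ B), Finset.filter_subset _ _, ?_⟩⟩
    · apply Finset.Subset.antisymm
      · intro x hx
        rcases K.cover x with ⟨j, hj⟩ | ⟨E, hE, hxE⟩
        · by_cases hij : i = j
          · rw [hij]
            exact Finset.mem_union_left _ hj
          · exact absurd (h1 j hj) (Finset.disjoint_left.1 (L.ferm_disjoint i j hij) hx)
        · refine Finset.mem_union_right _ (Finset.mem_biUnion.2 ⟨E, ?_, hxE⟩)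
          refine Finset.mem_filter.2 ⟨hE, key E hE x hxE _ ?_ hx⟩
          simp only [under, mem_union, mem_erase, mem_image, mem_univ, true_and]
          exact Or.inl ⟨Finset.ne_empty_of_mem hx, i, rfl⟩
      · refine Finset.union_subset (h1 i) (Finset.biUnion_subset.2 fun E hE => ?_)
        exact (Finset.mem_filter.1 hE).2
    · apply Finset.Subset.antisymm
      · intro x hx
        rcases K.cover x with ⟨j, hj⟩ | ⟨E, hE, hxE⟩
        · exact absurd hx (Finset.disjoint_left.1 (L.ferm_bos_disjoint j B hB) (h1 j hj))
        · refine Finset.mem_biUnion.2 ⟨E, ?_, hxE⟩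
          exact Finset.mem_filter.2 ⟨hE, key E hE x hxE _ (by simp [under, hB]) hx⟩
      · exact Finset.biUnion_subset.2 fun E hE => (Finset.mem_filter.1 hE).2

theorem mem_under {K : SetSupercomp n m} {B : Finset (Fin n)} :
    B ∈ K.under ↔ (B ≠ ∅ ∧ ∃ i, K.ferm i = B) ∨ B ∈ K.bos := by
  simp [under]

theorem subset_block_of_subset_under {K : SetSupercomp n m} {B E : Finset (Fin n)}
    (hB : B ∈ K.under) (hE : E ⊆ B) : (∃ i, E ⊆ K.ferm i) ∨ ∃ B ∈ K.bos, E ⊆ B := by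
  rcases mem_under.1 hB with ⟨_, i, rfl⟩ | h
  · exact Or.inl ⟨i, hE⟩
  · exact Or.inr ⟨B, h, hE⟩

/-- `K ⊓ L` is the greatest lower bound of `K` and `L` for the relation `⊑`. -/
theorem stronglyFiner_meet_iff {K L N : SetSupercomp n m} :
    N.StronglyFiner (K.meet L) ↔ N.StronglyFiner K ∧ N.StronglyFiner L := by
  constructor
  · intro h
    rw [stronglyFiner_iff] at h
    obtain ⟨h1, h2⟩ := h
    refine ⟨stronglyFiner_iff.2 ⟨fun i => (h1 i).trans Finset.inter_subset_left, fun E hE => ?_⟩,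
      stronglyFiner_iff.2 ⟨fun i => (h1 i).trans Finset.inter_subset_right, fun E hE => ?_⟩⟩
    all_goals
      rcases h2 E hE with ⟨i, hi⟩ | ⟨D, hD, hED⟩
    · exact Or.inl ⟨i, hi.trans Finset.inter_subset_left⟩
    · obtain ⟨p, hp, rfl⟩ := Finset.mem_image.1 (Finset.mem_of_mem_erase hD)
      exact subset_block_of_subset_under (Finset.mem_product.1 hp).1
        ((hED.trans Finset.inter_subset_left).trans Finset.sdiff_subset)
    · exact Or.inl ⟨i, hi.trans Finset.inter_subset_right⟩
    · obtain ⟨p, hp, rfl⟩ := Finset.mem_image.1 (Finset.mem_of_mem_erase hD)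
      exact subset_block_of_subset_under (Finset.mem_product.1 hp).2
        ((hED.trans Finset.inter_subset_right).trans Finset.sdiff_subset)
  · rintro ⟨hK, hL⟩
    rw [stronglyFiner_iff] at hK hL
    have aux : ∀ M : SetSupercomp n m, (∀ E ∈ N.bos, (∃ i, E ⊆ M.ferm i) ∨ ∃ B ∈ M.bos, E ⊆ B) →
        ∀ E ∈ N.bos, ∃ B ∈ M.under, E ⊆ B := by
      intro M hM E hE
      rcases hM E hE with ⟨i, hi⟩ | ⟨B, hB, hEB⟩
      · obtain ⟨x, hx⟩ := N.bos_nonempty E hE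
        exact ⟨_, mem_under.2 (Or.inl ⟨Finset.ne_empty_of_mem (hi hx), i, rfl⟩), hi⟩
      · exact ⟨B, mem_under.2 (Or.inr hB), hEB⟩
    refine stronglyFiner_iff.2 ⟨fun i => Finset.subset_inter (hK.1 i) (hL.1 i), fun E hE => ?_⟩
    obtain ⟨x, hx⟩ := N.bos_nonempty E hE
    obtain ⟨B, hB, hEB⟩ := aux K hK.2 E hE
    obtain ⟨C, hC, hEC⟩ := aux L hL.2 E hE
    have blk : ∀ (M : SetSupercomp n m) (B : Finset (Fin n)), B ∈ M.under → ∀ i, ∀ y ∈ B,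
        y ∈ M.ferm i → B = M.ferm i := fun M B hB i y hy hyi =>
      M.under_unique hB (mem_under.2 (Or.inl ⟨Finset.ne_empty_of_mem hyi, i, rfl⟩)) hy hyi
    by_cases hA : ∃ y ∈ E, y ∈ commonFerm K L
    · obtain ⟨y, hy, hyA⟩ := hA
      obtain ⟨i, hi1, hi2⟩ := mem_commonFerm.1 hyA
      left
      refine ⟨i, Finset.subset_inter ?_ ?_⟩
      · rwa [← blk K B hB i y (hEB hy) hi1]
      · rwa [← blk L C hC i y (hEC hy) hi2]
    · right
      have hsub : E ⊆ (B \ commonFerm K L) ∩ (C \ commonFerm K L) := by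
        intro y hy
        have hyA : y ∉ commonFerm K L := fun h => hA ⟨y, hy, h⟩
        simp [hEB hy, hEC hy, hyA]
      exact ⟨_, Finset.mem_erase.2 ⟨Finset.ne_empty_of_mem (hsub hx),
        Finset.mem_image.2 ⟨(B, C), Finset.mem_product.2 ⟨hB, hC⟩, rfl⟩⟩, hsub⟩

/-- `K! = |K_1|! ⋯ |K_q|!`, where the symbol `0` is counted in the fermionic blocks. -/
def blockFactorial (K : SetSupercomp n m) : ℕ :=
  (∏ i, ((K.ferm i).card + 1).factorial) * ∏ B ∈ K.bos, B.card.factorial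

theorem data_injective :
    Function.Injective fun K : SetSupercomp n m => (K.ferm, K.bos) := by
  intro K L h
  exact SetSupercomp.ext (congrArg Prod.fst h) (congrArg Prod.snd h)

instance : Fintype (SetSupercomp n m) := Fintype.ofInjective _ data_injective

theorem sum_card (K : SetSupercomp n m) :
    ∑ i, (K.ferm i).card + ∑ B ∈ K.bos, B.card = n := by
  have h1 : (univ.biUnion K.ferm).card = ∑ i, (K.ferm i).card :=
    Finset.card_biUnion fun i _ j _ h => K.ferm_disjoint i j h
  have h2 : (K.bos.biUnion id).card = ∑ B ∈ K.bos, B.card :=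
    Finset.card_biUnion fun B hB C hC h => K.bos_disjoint B hB C hC h
  have h3 : Disjoint (univ.biUnion K.ferm) (K.bos.biUnion id) := by
    rw [Finset.disjoint_biUnion_left]
    intro i _
    rw [Finset.disjoint_biUnion_right]
    intro B hB
    exact K.ferm_bos_disjoint i B hB
  have h4 : univ.biUnion K.ferm ∪ K.bos.biUnion id = univ := by
    ext x
    simpa using K.cover x
  rw [← h1, ← h2, ← Finset.card_union_of_disjoint h3, h4, Finset.card_univ, Fintype.card_fin]

end SetSupercomp

/-- The least element of a set of elements of `[n]`, with `min ∅ = 0`. -/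
def minZero {n : ℕ} (s : Finset (Fin n)) : ℕ :=
  if h : s.Nonempty then (s.min' h : ℕ) + 1 else 0

/-- A set superpartition of bidegree `(n, m)`: the blocks `I_1, I_2, …` are pairwise different and
`min (I_i \ I_j) < min (I_j \ I_i)` for `i < j`, where `min ∅ = 0`. Both conditions hold
automatically as soon as `I_j` is not fermionic. -/
structure SetSuperpartition (n m : ℕ) extends SetSupercomp n m where
  ferm_ne : ∀ i j, i < j → ferm i ≠ ferm j
  ferm_lt : ∀ i j, i < j → minZero (ferm i \ ferm j) < minZero (ferm j \ ferm i)

/-! ### Functions in superspace -/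

/-- The number of inversions of a finite sequence. -/
def inversions {m : ℕ} (a : Fin m → ℕ) : ℕ :=
  ((univ : Finset (Fin m × Fin m)).filter fun p => p.1 < p.2 ∧ a p.2 < a p.1).card

open Classical in
/-- The coefficient of `θ_S := θ_{s_1} ⋯ θ_{s_m}` (with `S = {s_1 < ⋯ < s_m}`) in
`θ_{a_1} ⋯ θ_{a_m}`, where the `θ`'s anticommute and so square to zero. -/
def thetaCoeff {m : ℕ} (a : Fin m → ℕ) (S : Finset ℕ) : ℚ :=
  if Function.Injective a ∧ univ.image a = S then (-1) ^ inversions a else 0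

/-- The functions in noncommuting variables in superspace: formal power series of bounded degree,
with rational coefficients, in noncommuting variables `x` and anticommuting variables `θ` that
commute with the `x`. Every monomial is up to sign uniquely of the form `θ_S x_{b_1} ⋯ x_{b_n}`,
and the coefficient of the latter in `f` is `f S [b_1, …, b_n]`. The variables are indexed by
`ℕ`. -/
def NCFun : Submodule ℚ (Finset ℕ → List ℕ → ℚ) where
  carrier := {f | ∃ d, ∀ S w, d < S.card + w.length → f S w = 0}
  zero_mem' := ⟨0, fun _ _ _ => rfl⟩
  add_mem' := by
    rintro f g ⟨d, hd⟩ ⟨e, he⟩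
    refine ⟨max d e, fun S w h => ?_⟩
    simp [hd S w (lt_of_le_of_lt (le_max_left _ _) h),
      he S w (lt_of_le_of_lt (le_max_right _ _) h)]
  smul_mem' := by
    rintro c f ⟨d, hd⟩
    exact ⟨d, fun S w h => by simp [hd S w h]⟩

/-- The formal sum of `c a b • θ_{a_1} ⋯ θ_{a_m} x_{b_1} ⋯ x_{b_n}` over all tuples of indices
`a = (a_1, …, a_m)` and `b = (b_1, …, b_n)`. In the coefficient of `θ_S x_w`, only the tuples `a`
with entries in `S` and the tuples `b` with entries in `w` can contribute, and the other ones are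
left out. -/
def ncSum {n m : ℕ} (c : (Fin m → ℕ) → (Fin n → ℕ) → ℚ) : NCFun where
  val S w := ∑ a ∈ Fintype.piFinset fun _ : Fin m => S,
    ∑ b ∈ Fintype.piFinset fun _ : Fin n => w.toFinset,
      c a b * (thetaCoeff a S * if List.ofFn b = w then 1 else 0)
  property := by
    refine ⟨m + n, fun S w h => Finset.sum_eq_zero fun a _ => Finset.sum_eq_zero fun b _ => ?_⟩
    by_cases h1 : Function.Injective a ∧ univ.image a = S
    · by_cases h2 : List.ofFn b = w
      · have h3 : S.card = m := by
          rw [← h1.2, Finset.card_image_of_injective _ h1.1, Finset.card_univ, Fintype.card_fin]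
        have h4 : w.length = n := by rw [← h2, List.length_ofFn]
        omega
      · simp [h2]
    · simp [thetaCoeff, h1]

section bases

variable {n m : ℕ}

/-- `θ_{a_1} ⋯ θ_{a_m} x_{b_1} ⋯ x_{b_n}` belongs to `M(K)`. -/
def InM (K : SetSupercomp n m) (a : Fin m → ℕ) (b : Fin n → ℕ) : Prop :=
  (∀ i j, a i = b j ↔ j ∈ K.ferm i) ∧ ∀ i j, b i = b j ↔ K.SameBlock i j

/-- `θ_{a_1} ⋯ θ_{a_m} x_{b_1} ⋯ x_{b_n}` belongs to `P(K)`. -/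
def InP (K : SetSupercomp n m) (a : Fin m → ℕ) (b : Fin n → ℕ) : Prop :=
  (∀ i, ∀ j ∈ K.ferm i, a i = b j) ∧ ∀ i j, K.SameBlock i j → b i = b j

/-- `θ_{a_1} ⋯ θ_{a_m} x_{b_1} ⋯ x_{b_n}` belongs to `E(K)`. -/
def InE (K : SetSupercomp n m) (a : Fin m → ℕ) (b : Fin n → ℕ) : Prop :=
  (∀ i, ∀ j ∈ K.ferm i, a i ≠ b j) ∧ ∀ i j, i ≠ j → K.SameBlock i j → b i ≠ b j

/-- `{a_1, …, a_m} \ {b_1, …, b_n}` has more than one element. -/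
def NullSymmetric (a : Fin m → ℕ) (b : Fin n → ℕ) : Prop :=
  1 < (univ.image a \ univ.image b).card

open Classical in
/-- The monomial function `m_K` in noncommuting variables. -/
def ncMonomial (K : SetSupercomp n m) : NCFun :=
  ncSum fun a b => if InM K a b then 1 else 0

open Classical in
/-- The power sum function `p_K` in noncommuting variables. -/
def ncPower (K : SetSupercomp n m) : NCFun :=
  ncSum fun a b => if InP K a b then 1 else 0

open Classical in
/-- The elementary function `e_K` in noncommuting variables. -/
def ncElementary (K : SetSupercomp n m) : NCFun :=
  ncSum fun a b => if InE K a b then 1 else 0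

open Classical in
/-- The complete homogeneous function `h_K = ∑_u c_u u` in noncommuting variables, where `u` runs
over the monomials that are not null-symmetric, and `c_u = (K ⊓ L)!` for the unique `L` with
`u ∈ M(L)`; the sum over `L` only picks this one. -/
def ncHomogeneous (K : SetSupercomp n m) : NCFun :=
  ncSum fun a b => if NullSymmetric a b then 0 else
    ∑ L : SetSupercomp n m, if InM L a b then ((K.meet L).blockFactorial : ℚ) else 0

end bases

/-! ### Commuting variables -/

/-- The functions in commuting variables in superspace: formal power series of bounded degree with
rational coefficients in commuting variables `x` and anticommuting variables `θ`. The power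
series in `x` that multiplies `θ_S` is `f S`. -/
def CFun : Submodule ℚ (Finset ℕ → MvPowerSeries ℕ ℚ) where
  carrier := {f | ∃ d, ∀ S α, d < S.card + α.degree → MvPowerSeries.coeff α (f S) = 0}
  zero_mem' := ⟨0, fun _ _ _ => by simp⟩
  add_mem' := by
    rintro f g ⟨d, hd⟩ ⟨e, he⟩
    refine ⟨max d e, fun S α h => ?_⟩
    simp [hd S α (lt_of_le_of_lt (le_max_left _ _) h),
      he S α (lt_of_le_of_lt (le_max_right _ _) h)]
  smul_mem' := by
    rintro c f ⟨d, hd⟩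
    exact ⟨d, fun S α h => by simp [hd S α h]⟩

/-- The number of pairs `(t, u) ∈ T × U` with `u < t`; for disjoint `T, U` we have
`θ_T θ_U = (-1) ^ crossings T U • θ_{T ∪ U}`. -/
def crossings (T U : Finset ℕ) : ℕ := ((T ×ˢ U).filter fun p => p.2 < p.1).card

theorem crossings_union_left {T U V : Finset ℕ} (h : Disjoint T U) :
    crossings (T ∪ U) V = crossings T V + crossings U V := by
  rw [crossings, Finset.union_product, Finset.filter_union, Finset.card_union_of_disjoint]
  · rfl
  · exact Finset.disjoint_filter_filter (Finset.disjoint_product.2 (Or.inl h))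

theorem crossings_union_right {T U V : Finset ℕ} (h : Disjoint U V) :
    crossings T (U ∪ V) = crossings T U + crossings T V := by
  rw [crossings, Finset.product_union, Finset.filter_union, Finset.card_union_of_disjoint]
  · rfl
  · exact Finset.disjoint_filter_filter (Finset.disjoint_product.2 (Or.inr h))

/-- The product of series in commuting `x` and anticommuting `θ`:
`(f g)_S = ∑ ± f_T g_U` over all decompositions of `S` into disjoint sets `T` and `U`. -/
def superMul {R : Type*} [CommRing R] (f g : Finset ℕ → R) : Finset ℕ → R := fun S =>
  ∑ T ∈ S.powerset, (-1) ^ crossings T (S \ T) * (f T * g (S \ T))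

theorem superMul_assoc {R : Type*} [CommRing R] (f g h : Finset ℕ → R) :
    superMul (superMul f g) h = superMul f (superMul g h) := by
  funext S
  simp only [superMul, Finset.sum_mul, Finset.mul_sum]
  rw [Finset.sum_sigma', Finset.sum_sigma']
  refine Finset.sum_bij' (fun p _ => ⟨p.2, p.1 \ p.2⟩) (fun p _ => ⟨p.1 ∪ p.2, p.1⟩) ?_ ?_ ?_ ?_ ?_
  · rintro ⟨V, T⟩ hp
    simp only [mem_sigma, mem_powerset] at hp ⊢
    exact ⟨hp.2.trans hp.1, Finset.sdiff_subset_sdiff hp.1 (Finset.Subset.refl _)⟩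
  · rintro ⟨T, U⟩ hp
    simp only [mem_sigma, mem_powerset] at hp ⊢
    exact ⟨Finset.union_subset hp.1 (hp.2.trans Finset.sdiff_subset), Finset.subset_union_left⟩
  · rintro ⟨V, T⟩ hp
    simp only [mem_sigma, mem_powerset] at hp
    simp [Finset.union_sdiff_of_subset hp.2]
  · rintro ⟨T, U⟩ hp
    simp only [mem_sigma, mem_powerset] at hp
    have hd : Disjoint U T := (Finset.disjoint_sdiff.mono_right hp.2).symm
    simp [Finset.union_sdiff_cancel_left hd.symm]
  · rintro ⟨V, T⟩ hp
    simp only [mem_sigma, mem_powerset] at hp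
    obtain ⟨hV, hT⟩ := hp
    have e1 : (S \ T) \ (V \ T) = S \ V := by
      ext x
      have := @hT x
      simp only [mem_sdiff]
      tauto
    have e2 : S \ T = (V \ T) ∪ (S \ V) := by
      ext x
      have := @hV x
      have := @hT x
      simp only [mem_sdiff, mem_union]
      tauto
    have d1 : Disjoint (V \ T) (S \ V) := by
      rw [Finset.disjoint_left]
      intro x
      simp only [mem_sdiff]
      tauto
    have c1 : crossings T (S \ T) = crossings T (V \ T) + crossings T (S \ V) := by
      rw [e2, crossings_union_right d1]
    have c2 : crossings V (S \ V) = crossings T (S \ V) + crossings (V \ T) (S \ V) := by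
      conv_lhs => rw [← Finset.union_sdiff_of_subset hT]
      rw [crossings_union_left Finset.disjoint_sdiff, Finset.union_sdiff_of_subset hT]
    simp only [e1, c1, c2, pow_add]
    ring

/-- The unit series `1`. -/
def superOne {R : Type*} [CommRing R] : Finset ℕ → R := fun S => if S = ∅ then 1 else 0

theorem superOne_mul {R : Type*} [CommRing R] (f : Finset ℕ → R) : superMul superOne f = f := by
  funext S
  rw [superMul, Finset.sum_eq_single ∅]
  · simp [superOne, crossings]
  · intro T _ hT
    simp [superOne, hT]
  · simp

theorem superMul_one {R : Type*} [CommRing R] (f : Finset ℕ → R) : superMul f superOne = f := by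
  funext S
  rw [superMul, Finset.sum_eq_single S]
  · simp [superOne, crossings]
  · intro T hT hne
    have : S \ T ≠ ∅ := fun h =>
      hne (Finset.Subset.antisymm (mem_powerset.1 hT) (Finset.sdiff_eq_empty_iff_subset.1 h))
    simp [superOne, this]
  · simp

theorem superMul_mem {f g : Finset ℕ → MvPowerSeries ℕ ℚ} (hf : f ∈ CFun) (hg : g ∈ CFun) :
    superMul f g ∈ CFun := by
  classical
  obtain ⟨d, hd⟩ := hf
  obtain ⟨e, he⟩ := hg
  refine ⟨d + e, fun S α h => ?_⟩
  rw [superMul, map_sum]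
  refine Finset.sum_eq_zero fun T hT => ?_
  have hz : MvPowerSeries.coeff α (f T * g (S \ T)) = 0 := by
    rw [MvPowerSeries.coeff_mul]
    refine Finset.sum_eq_zero fun p hp => ?_
    have h1 : p.1.degree + p.2.degree = α.degree := by
      rw [← Finset.HasAntidiagonal.mem_antidiagonal.1 hp, map_add]
    have h2 : T.card + (S \ T).card = S.card := by
      rw [add_comm]
      exact Finset.card_sdiff_add_card_eq_card (mem_powerset.1 hT)
    by_cases h3 : d < T.card + p.1.degree
    · rw [hd T p.1 h3, zero_mul]
    · rw [he (S \ T) p.2 (by omega), mul_zero]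
  rcases neg_one_pow_eq_or (MvPowerSeries ℕ ℚ) (crossings T (S \ T)) with h' | h' <;>
    simp [h', hz]

instance : Monoid CFun where
  mul f g := ⟨superMul f.1 g.1, superMul_mem f.2 g.2⟩
  one := ⟨superOne, 0, fun S α h => by
    classical
    by_cases hS : S = ∅
    · subst hS
      have hα : α ≠ 0 := by
        rintro rfl
        simp at h
      simp [superOne, MvPowerSeries.coeff_one, hα]
    · simp [superOne, hS]⟩
  mul_assoc f g h := Subtype.ext (superMul_assoc f.1 g.1 h.1)
  one_mul f := Subtype.ext (superOne_mul f.1)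
  mul_one f := Subtype.ext (superMul_one f.1)

/-- The projection `ρ` that lets the `x`-variables commute: `θ_S x_{b_1} ⋯ x_{b_n}` is sent to
`θ_S` times the commutative monomial `x_{b_1} ⋯ x_{b_n}`. Thus the coefficient of `θ_S x^α` in
`ρ f` is the sum of the coefficients in `f` of the finitely many `θ_S x_{b_1} ⋯ x_{b_n}` such that
`(b_1, …, b_n)` is a rearrangement of the multiset of indices of `x^α`. -/
def rho : NCFun →ₗ[ℚ] CFun where
  toFun f := ⟨fun S α => ∑ w ∈ α.toMultiset.lists.toFinset, f.1 S w, by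
    obtain ⟨d, hd⟩ := f.2
    refine ⟨d, fun S α h => ?_⟩
    change ∑ w ∈ α.toMultiset.lists.toFinset, f.1 S w = 0
    refine Finset.sum_eq_zero fun w hw => hd S w ?_
    have h1 : α.toMultiset = (w : Multiset ℕ) := by
      simpa [Multiset.mem_lists_iff] using hw
    have h2 : w.length = α.degree := by
      rw [← Multiset.coe_card, ← h1, Finsupp.card_toMultiset]
      rfl
    rwa [h2]⟩
  map_add' f g := by
    apply Subtype.ext
    funext S α
    exact Finset.sum_add_distrib
  map_smul' c f := by
    apply Subtype.ext
    funext S α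
    exact (Finset.mul_sum _ _ _).symm

/-- A superpartition `Λ = (Λ^a ; Λ^s)` of degree `n` and fermionic degree `m`: `Λ^a = anti` is
strictly decreasing, with `0` allowed, and `Λ^s = sym` is a partition into positive parts, listed
in weakly decreasing order. -/
@[ext]
structure Superpartition (n m : ℕ) where
  anti : Fin m → ℕ
  sym : List ℕ
  anti_strictAnti : StrictAnti anti
  sym_sorted : sym.Pairwise (· ≥ ·)
  sym_pos : ∀ r ∈ sym, 0 < r
  sum_eq : ∑ i, anti i + sym.sum = n

namespace Superpartition

variable {n m : ℕ}

/-- `Λ! = ∏ Λ_i!`. -/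
def factorial (Λ : Superpartition n m) : ℕ :=
  (∏ i, (Λ.anti i).factorial) * (Λ.sym.map Nat.factorial).prod

/-- `(Λ^s)^! = ∏_r k_r!`, where `k_r` is the multiplicity of `r` in `Λ^s`. -/
def symMultFactorial (Λ : Superpartition n m) : ℕ :=
  ∏ r ∈ Λ.sym.toFinset, (Λ.sym.count r).factorial

instance : Finite (Superpartition n m) := by
  have hfin : Finite {l : List (Fin (n + 1)) // l.length ≤ n} :=
    (List.finite_length_le (Fin (n + 1)) n).to_subtype
  have hlen : ∀ l : List ℕ, (∀ r ∈ l, 0 < r) → l.length ≤ l.sum := by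
    intro l
    induction l with
    | nil => simp
    | cons r l ih =>
      intro h
      have h1 := ih fun s hs => h s (List.mem_cons_of_mem _ hs)
      have h2 := h r List.mem_cons_self
      simp only [List.length_cons, List.sum_cons]
      omega
  let F : Superpartition n m → (Fin m → Fin (n + 1)) × {l : List (Fin (n + 1)) // l.length ≤ n} :=
    fun Λ => (fun i => Fin.ofNat (n + 1) (Λ.anti i), ⟨Λ.sym.map (Fin.ofNat (n + 1)), by
      have h1 := hlen Λ.sym Λ.sym_pos
      have h2 := Λ.sum_eq
      rw [List.length_map]
      omega⟩)
  refine Finite.of_injective F fun Λ Ω h => ?_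
  have ha : ∀ (Λ : Superpartition n m) i, Λ.anti i < n + 1 := by
    intro Λ i
    have h1 : Λ.anti i ≤ ∑ i, Λ.anti i :=
      Finset.single_le_sum (f := Λ.anti) (fun _ _ => Nat.zero_le _) (mem_univ i)
    have h2 := Λ.sum_eq
    omega
  have hs : ∀ (Λ : Superpartition n m),
      ((Λ.sym.map (Fin.ofNat (n + 1))).map Fin.val) = Λ.sym := by
    intro Λ
    rw [List.map_map]
    conv_rhs => rw [← List.map_id Λ.sym]
    refine List.map_congr_left fun r hr => ?_
    have h1 : r ≤ Λ.sym.sum := List.le_sum_of_mem hr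
    have h2 := Λ.sum_eq
    simp only [Function.comp, Fin.val_ofNat, id]
    exact Nat.mod_eq_of_lt (by omega)
  apply Superpartition.ext
  · funext i
    have h1 := congrArg Fin.val (congrFun (congrArg Prod.fst h) i)
    simp only [F, Fin.val_ofNat] at h1
    rwa [Nat.mod_eq_of_lt (ha Λ i), Nat.mod_eq_of_lt (ha Ω i)] at h1
  · have h1 := congrArg (fun p => p.2.1.map Fin.val) h
    simp only [F] at h1
    rwa [hs, hs] at h1

instance : Fintype (Superpartition n m) := Fintype.ofFinite _

end Superpartition

/-- The monomial `θ_{a_1} ⋯ θ_{a_m} x^α` in commuting variables. -/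
def cTerm {m : ℕ} (a : Fin m → ℕ) (α : ℕ →₀ ℕ) : Finset ℕ → MvPowerSeries ℕ ℚ :=
  fun S => thetaCoeff a S • MvPowerSeries.monomial α (1 : ℚ)

/-- The exponent of `x_{i_1}^{Λ_1} ⋯ x_{i_m}^{Λ_m} x_{j_1}^{Λ_{m+1}} ⋯ x_{j_l}^{Λ_{m+l}}`. -/
def expo {n m : ℕ} (Λ : Superpartition n m) (i : Fin m → ℕ) (j : Fin Λ.sym.length → ℕ) :
    ℕ →₀ ℕ :=
  ∑ t, Finsupp.single (i t) (Λ.anti t) + ∑ t, Finsupp.single (j t) (Λ.sym.get t)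

theorem expo_degree {n m : ℕ} (Λ : Superpartition n m) (i : Fin m → ℕ)
    (j : Fin Λ.sym.length → ℕ) : (expo Λ i j).degree = n := by
  have h : ∑ t, Λ.sym.get t = Λ.sym.sum := by
    rw [← List.sum_ofFn, List.ofFn_get]
  rw [expo, map_add, map_sum, map_sum]
  simp only [Finsupp.degree_single]
  rw [h, Λ.sum_eq]

/-- The terms `θ_{i_1} ⋯ θ_{i_m} x_{i_1}^{Λ_1} ⋯ x_{i_k}^{Λ_k}`, with pairwise different indices
`i_1, …, i_k`. As this is a set, no term is repeated. -/
def cTerms {n m : ℕ} (Λ : Superpartition n m) : Set (Finset ℕ → MvPowerSeries ℕ ℚ) :=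
  {t | ∃ (i : Fin m → ℕ) (j : Fin Λ.sym.length → ℕ),
    Function.Injective (Sum.elim i j) ∧ t = cTerm i (expo Λ i j)}

theorem cTerm_coeff_ne_zero {m : ℕ} {a : Fin m → ℕ} {α β : ℕ →₀ ℕ} {S : Finset ℕ}
    (h : MvPowerSeries.coeff β (cTerm a α S) ≠ 0) :
    Function.Injective a ∧ univ.image a = S ∧ α = β := by
  classical
  by_cases h1 : Function.Injective a ∧ univ.image a = S
  · refine ⟨h1.1, h1.2, ?_⟩
    by_contra h2
    apply h
    simp [cTerm, MvPowerSeries.coeff_monomial, Ne.symm h2]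
  · exact absurd (by simp [cTerm, thetaCoeff, h1]) h

/-- The monomial symmetric function `m_Λ`: the formal sum of the different terms in
`cTerms Λ`. The sum is finite in each coefficient, see `cMonomial_finite`. -/
def cMonomial {n m : ℕ} (Λ : Superpartition n m) : CFun where
  val S α := ∑ᶠ t ∈ cTerms Λ, MvPowerSeries.coeff α (t S)
  property := by
    refine ⟨m + n, fun S α h => ?_⟩
    change ∑ᶠ t ∈ cTerms Λ, MvPowerSeries.coeff α (t S) = 0
    refine finsum_mem_eq_zero_of_forall_eq_zero ?_
    rintro t ⟨i, j, _, rfl⟩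
    by_contra hne
    obtain ⟨h1, h2, h3⟩ := cTerm_coeff_ne_zero hne
    have h4 : S.card = m := by
      rw [← h2, Finset.card_image_of_injective _ h1, Finset.card_univ, Fintype.card_fin]
    have h5 := expo_degree Λ i j
    rw [h3] at h5
    omega

theorem cMonomial_finite {n m : ℕ} (Λ : Superpartition n m) (S : Finset ℕ) (α : ℕ →₀ ℕ) :
    {t ∈ cTerms Λ | MvPowerSeries.coeff α (t S) ≠ 0}.Finite := by
  refine (((Fintype.piFinset fun _ : Fin m => S).finite_toSet).image
    fun a => cTerm a α).subset ?_
  rintro t ⟨⟨i, j, _, rfl⟩, hne⟩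
  obtain ⟨_, h2, h3⟩ := cTerm_coeff_ne_zero hne
  refine ⟨i, ?_, by rw [h3]⟩
  rw [Finset.mem_coe, Fintype.mem_piFinset]
  intro t
  rw [← h2]
  exact Finset.mem_image_of_mem _ (mem_univ t)

/-- `p_r = ∑_i x_i^r`, for `r ≥ 1`; only the indices `i` in the support of `α` can contribute to
the coefficient of `x^α`. -/
def cPowerSum (r : ℕ) : CFun where
  val S α := if S = ∅ then ∑ i ∈ α.support, if α = Finsupp.single i r then 1 else 0 else 0
  property := by
    refine ⟨r, fun S α h => ?_⟩
    change (if S = ∅ then ∑ i ∈ α.support, if α = Finsupp.single i r then (1 : ℚ) else 0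
      else 0) = 0
    split_ifs with hS
    · refine Finset.sum_eq_zero fun i _ => if_neg ?_
      rintro rfl
      rw [hS, Finsupp.degree_single, Finset.card_empty] at h
      omega
    · rfl

/-- `p̃_k = ∑_i θ_i x_i^k`. -/
def cPowerSumTilde (k : ℕ) : CFun where
  val S := ∑ i ∈ S, if S = {i} then MvPowerSeries.X i ^ k else 0
  property := by
    classical
    refine ⟨k + 1, fun S α h => ?_⟩
    rw [map_sum]
    refine Finset.sum_eq_zero fun i _ => ?_
    split_ifs with hS
    · rw [MvPowerSeries.coeff_X_pow, if_neg]
      rintro rfl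
      rw [hS, Finsupp.degree_single, Finset.card_singleton] at h
      omega
    · simp

/-- The superpartition `(∅ ; 1^r)`. -/
def onesSym (r : ℕ) : Superpartition r 0 where
  anti := Fin.elim0
  sym := List.replicate r 1
  anti_strictAnti i := i.elim0
  sym_sorted := by simp [List.pairwise_replicate]
  sym_pos := by simp [List.mem_replicate]
  sum_eq := by simp

/-- The superpartition `(0 ; 1^k)`. -/
def zeroOnes (k : ℕ) : Superpartition k 1 where
  anti _ := 0
  sym := List.replicate k 1
  anti_strictAnti i j h := absurd h (by simp [Subsingleton.elim i j])
  sym_sorted := by simp [List.pairwise_replicate]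
  sym_pos := by simp [List.mem_replicate]
  sum_eq := by simp

/-- `e_r = m_{(∅; 1^r)}`. -/
def cElem (r : ℕ) : CFun := cMonomial (onesSym r)

/-- `ẽ_k = m_{(0; 1^k)}`. -/
def cElemTilde (k : ℕ) : CFun := cMonomial (zeroOnes k)

/-- `h_r = ∑ m_Λ`, over the superpartitions `Λ` of bidegree `(r, 0)`. -/
def cHom (r : ℕ) : CFun := ∑ Λ : Superpartition r 0, cMonomial Λ

/-- `h̃_k = ∑ (Λ_1 + 1) m_Λ`, over the superpartitions `Λ` of bidegree `(k, 1)`. -/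
def cHomTilde (k : ℕ) : CFun :=
  ∑ Λ : Superpartition k 1, ((Λ.anti 0 : ℚ) + 1) • cMonomial Λ

section bases

variable {n m : ℕ}

/-- `p_Λ = p̃_{Λ_1} ⋯ p̃_{Λ_m} p_{Λ_{m+1}} ⋯ p_{Λ_k}`. -/
def cPower (Λ : Superpartition n m) : CFun :=
  (List.ofFn fun i => cPowerSumTilde (Λ.anti i)).prod * (Λ.sym.map cPowerSum).prod

/-- `e_Λ = ẽ_{Λ_1} ⋯ ẽ_{Λ_m} e_{Λ_{m+1}} ⋯ e_{Λ_k}`. -/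
def cElementary (Λ : Superpartition n m) : CFun :=
  (List.ofFn fun i => cElemTilde (Λ.anti i)).prod * (Λ.sym.map cElem).prod

/-- `h_Λ = h̃_{Λ_1} ⋯ h̃_{Λ_m} h_{Λ_{m+1}} ⋯ h_{Λ_k}`. -/
def cHomogeneous (Λ : Superpartition n m) : CFun :=
  (List.ofFn fun i => cHomTilde (Λ.anti i)).prod * (Λ.sym.map cHom).prod

/-! ### The type and the sign of a set superpartition -/

/-- The sequence `(|I_1| - 1, …, |I_m| - 1)` given by the fermionic blocks. -/
def SetSupercomp.fermSize (K : SetSupercomp n m) (i : Fin m) : ℕ := (K.ferm i).card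

/-- The superpartition
`Λ(I) = sort(|I_1| - 1, …, |I_m| - 1; |I_{m+1}|, …, |I_k|)`, when the fermionic blocks of `I` have
pairwise different sizes. -/
def SetSuperpartition.type (I : SetSuperpartition n m) (h : Function.Injective I.fermSize) :
    Superpartition n m where
  anti i := I.fermSize (Tuple.sort I.fermSize i.rev)
  sym := (I.bos.val.map Finset.card).sort (· ≥ ·)
  anti_strictAnti i j hij := by
    have h1 := Tuple.monotone_sort I.fermSize (Fin.rev_le_rev.2 hij.le)
    refine lt_of_le_of_ne h1 fun h2 => ?_
    exact hij.ne' (Fin.rev_injective ((Tuple.sort I.fermSize).injective (h h2)))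
  sym_sorted := Multiset.pairwise_sort _ _
  sym_pos r hr := by
    rw [Multiset.mem_sort, Multiset.mem_map] at hr
    obtain ⟨B, hB, rfl⟩ := hr
    exact Finset.card_pos.2 (I.bos_nonempty B hB)
  sum_eq := by
    have h1 : ∑ i, I.fermSize (Tuple.sort I.fermSize (Fin.rev i)) = ∑ i, (I.ferm i).card :=
      Equiv.sum_comp (Fin.revPerm.trans (Tuple.sort I.fermSize)) I.fermSize
    have h2 : ((I.bos.val.map Finset.card).sort (· ≥ ·)).sum = ∑ B ∈ I.bos, B.card := by
      rw [← Multiset.sum_coe, Multiset.sort_eq]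
      rfl
    rw [h1, h2]
    exact I.sum_card

/-- `ε(I)`: the least number of transpositions that are needed to obtain `Λ(I)^a` from
`(|I_1| - 1, …, |I_m| - 1)`. -/
def SetSuperpartition.eps (I : SetSuperpartition n m) (h : Function.Injective I.fermSize) : ℕ :=
  sInf {k | ∃ l : List (Equiv.Perm (Fin m)), l.length = k ∧ (∀ τ ∈ l, τ.IsSwap) ∧
    I.fermSize ∘ l.prod = (I.type h).anti}

end bases

end Superspace

end

noncomputable section

namespace Superspace

/-! Everything is compared coefficientwise. For f = ∑ c(a,b) θ_a x_b, the coefficient of θ_S x^α in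
ρ(f) is an alternating sum (`thetaSum`) over the enumerations a of S, whose inner term is the sum of
c(a,b) over all words b with content α (`coeff_rho_ncSum`).

For p, e and h the coefficient c(a,b) can be taken to be a product over the blocks of K, where the
factor of a block depends only on the content β of b restricted to that block and, for K_i, on a_i.
A word on [n] is a tuple of words on the blocks, and β is the content of r!/β! words of length r. So
the inner sum is a coefficient of a product of commutative series, one for each block
(`BlockData.sum_weight`). Up to a scalar (1 for p, r! for e and h) these series are the factors of
p_Λ, e_Λ, h_Λ; `BlockData` records exactly this. Conversely, expanding a product of odd factors
gives the same kind of alternating sum, with the sizes in decreasing order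
(`CFun.coeff_multiplicative`). Passing from one order to the other permutes a and costs the sign of
the sorting permutation, which is (-1)^ε. If two fermionic blocks have equal sizes, exchanging the
corresponding entries of a fixes the inner sum but reverses the sign, so the total is 0.

Two more facts are needed for h. First, (K ⊓ L)! is a product over the blocks of K, with factors
(β(a_i)+1)·β! and β! (`blockFactorial_meet`). Second, leaving out the null-symmetric monomials
changes nothing after ρ: exchanging two entries of a that do not occur in b preserves this product,
so their contributions would cancel.

For m the coefficient is not such a product, since different blocks must carry different letters.
Given a, the words of M(K) with content α correspond to the size-preserving bijections from the
nonfermionic blocks to the remaining variables of x^α; if there are any, there are ∏ k_r! of them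
(`card_inM`). The sign argument is the same. -/

/-! ### Signs and alternating sums over the θ-indices -/

theorem neg_one_pow_inversions {m : ℕ} {a : Fin m → ℕ} (ha : Function.Injective a) :
    (-1 : ℚ) ^ inversions a = ∏ i, ∏ j ∈ Ioi i, ((SignType.sign ((a j : ℤ) - a i) : ℤ) : ℚ) := by
  have h : ∀ i, ∀ j ∈ Ioi i, ((SignType.sign ((a j : ℤ) - a i) : ℤ) : ℚ) =
      if a j < a i then -1 else 1 := by
    intro i j hij
    have hne : a j ≠ a i := fun h => (mem_Ioi.1 hij).ne' (ha h)
    split_ifs with h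
    · rw [sign_neg (by omega)]; simp
    · rw [sign_pos (by omega)]; simp
  rw [prod_congr rfl fun i _ => prod_congr rfl (h i), prod_sigma', prod_ite]
  simp only [prod_const, one_pow, mul_one]
  congr 1
  refine card_bij' (fun p _ => ⟨p.1, p.2⟩) (fun p _ => (p.1, p.2)) ?_ ?_ ?_ ?_ <;> simp

theorem thetaCoeff_comp_perm {m : ℕ} (a : Fin m → ℕ) (σ : Equiv.Perm (Fin m)) (S : Finset ℕ) :
    thetaCoeff (a ∘ σ) S = ((Equiv.Perm.sign σ : ℤ) : ℚ) * thetaCoeff a S := by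
  have himg : univ.image (a ∘ σ) = univ.image a := by
    ext x
    simp only [mem_image, mem_univ, true_and, Function.comp]
    exact ⟨fun ⟨i, hi⟩ => ⟨σ i, hi⟩, fun ⟨i, hi⟩ => ⟨σ.symm i, by simpa using hi⟩⟩
  by_cases h : Function.Injective a ∧ univ.image a = S
  · have h' : Function.Injective (a ∘ σ) ∧ univ.image (a ∘ σ) = S :=
      ⟨h.1.comp σ.injective, himg.trans h.2⟩
    rw [thetaCoeff, thetaCoeff, if_pos h, if_pos h', neg_one_pow_inversions h.1,
      neg_one_pow_inversions h'.1]
    -- A product over pairs i < j of a function that is antisymmetric in (i, j) picks up the sign of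
    -- σ under reindexing.
    exact σ.prod_Ioi_comp_eq_sign_mul_prod
      (f := fun i j => ((SignType.sign ((a j : ℤ) - a i) : ℤ) : ℚ)) fun i j => by
        rw [← neg_sub (a i : ℤ), Left.sign_neg]
        simp
  · have h' : ¬ (Function.Injective (a ∘ σ) ∧ univ.image (a ∘ σ) = S) := by
      rw [himg]
      exact fun h2 => h ⟨(Function.Injective.of_comp_iff' a σ.bijective).1 h2.1, h2.2⟩
    rw [thetaCoeff, thetaCoeff, if_neg h, if_neg h', mul_zero]

/-- The coefficient of `θ_S` in the sum of the `w a • θ_{a_1} ⋯ θ_{a_m}`. -/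
def thetaSum {m : ℕ} (w : (Fin m → ℕ) → ℚ) (S : Finset ℕ) : ℚ :=
  ∑ a ∈ Fintype.piFinset fun _ : Fin m => S, thetaCoeff a S * w a

theorem thetaSum_congr {m : ℕ} {w w' : (Fin m → ℕ) → ℚ} {S : Finset ℕ}
    (h : ∀ a, Function.Injective a → univ.image a = S → w a = w' a) :
    thetaSum w S = thetaSum w' S := by
  refine sum_congr rfl fun a _ => ?_
  by_cases h1 : Function.Injective a ∧ univ.image a = S
  · rw [h a h1.1 h1.2]
  · simp [thetaCoeff, h1]

theorem thetaSum_mul_left {m : ℕ} (c : ℚ) (w : (Fin m → ℕ) → ℚ) (S : Finset ℕ) :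
    thetaSum (fun a => c * w a) S = c * thetaSum w S := by
  rw [thetaSum, thetaSum, mul_sum]
  exact sum_congr rfl fun a _ => by ring

theorem thetaSum_comp_perm {m : ℕ} (w : (Fin m → ℕ) → ℚ) (σ : Equiv.Perm (Fin m))
    (S : Finset ℕ) :
    thetaSum (fun a => w (a ∘ σ)) S = ((Equiv.Perm.sign σ : ℤ) : ℚ) * thetaSum w S := by
  rw [thetaSum, thetaSum, mul_sum]
  refine sum_bij' (fun a _ => a ∘ σ) (fun a _ => a ∘ σ.symm) ?_ ?_ ?_ ?_ ?_
  · intro a ha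
    simp only [Fintype.mem_piFinset] at ha ⊢
    exact fun i => ha _
  · intro a ha
    simp only [Fintype.mem_piFinset] at ha ⊢
    exact fun i => ha _
  · intro a _
    ext i
    simp
  · intro a _
    ext i
    simp
  · intro a _
    rw [thetaCoeff_comp_perm, ← mul_assoc, ← mul_assoc, ← Int.cast_mul, ← Units.val_mul,
      Int.units_mul_self]
    simp

/-- The substitution that exchanges two entries is an involution that fixes w and reverses the sign.
This gives the vanishing when two fermionic blocks have equal sizes. -/
theorem thetaSum_eq_zero {m : ℕ} {w : (Fin m → ℕ) → ℚ} {S : Finset ℕ} {i j : Fin m} (hij : i ≠ j)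
    (h : ∀ a, w (a ∘ Equiv.swap i j) = w a) : thetaSum w S = 0 := by
  have h1 := thetaSum_comp_perm w (Equiv.swap i j) S
  rw [funext h, Equiv.Perm.sign_swap hij] at h1
  simp only [Units.val_neg, Units.val_one, Int.cast_neg, Int.cast_one] at h1
  linarith

/-- Exchanging two values changes the sign. -/
theorem thetaSum_eq_zero_of_swap_values {m : ℕ} {w : (Fin m → ℕ) → ℚ} {S : Finset ℕ} {u v : ℕ}
    (hu : u ∈ S) (hv : v ∈ S) (huv : u ≠ v)
    (h : ∀ a, Function.Injective a → univ.image a = S → w (Equiv.swap u v ∘ a) = w a) :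
    thetaSum w S = 0 := by
  have key : thetaSum w S = - thetaSum w S := by
    conv_rhs => rw [thetaSum]
    rw [← sum_neg_distrib]
    refine sum_bij' (fun a _ => Equiv.swap u v ∘ a) (fun a _ => Equiv.swap u v ∘ a) ?_ ?_ ?_ ?_ ?_
    · intro a ha
      simp only [Fintype.mem_piFinset, Function.comp] at ha ⊢
      intro i
      rw [Equiv.swap_apply_def]
      split_ifs <;> simp_all
    · intro a ha
      simp only [Fintype.mem_piFinset, Function.comp] at ha ⊢
      intro i
      rw [Equiv.swap_apply_def]
      split_ifs <;> simp_all
    · intro a _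
      ext i
      simp
    · intro a _
      ext i
      simp
    · intro a _
      by_cases h1 : Function.Injective a ∧ univ.image a = S
      · obtain ⟨i, _, hi⟩ := mem_image.1 (h1.2 ▸ hu)
        obtain ⟨j, _, hj⟩ := mem_image.1 (h1.2 ▸ hv)
        have hij : i ≠ j := by
          rintro rfl
          exact huv (hi.symm.trans hj)
        rw [h a h1.1 h1.2]
        -- Since a is injective with a i = u and a j = v, exchanging the values u, v is the same as
        -- exchanging the positions i, j, which has sign -1.
        have h2 : Equiv.swap u v ∘ a = a ∘ Equiv.swap i j := by
          rw [← hi, ← hj]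
          exact h1.1.swap_comp i j
        rw [h2, thetaCoeff_comp_perm, Equiv.Perm.sign_swap hij]
        simp
      -- If a is not an enumeration of S, neither is its swap, because u and v both lie in S; so
      -- both terms vanish.
      · have h2 : ¬ (Function.Injective (Equiv.swap u v ∘ a) ∧
            univ.image (Equiv.swap u v ∘ a) = S) := by
          rintro ⟨h3, h4⟩
          have h5 : Function.Injective a := Function.Injective.of_comp h3
          refine h1 ⟨h5, ?_⟩
          have h6 : (univ.image a).card = S.card := by
            rw [← h4, card_image_of_injective _ h5, card_image_of_injective _ h3]
          refine eq_of_subset_of_card_le (fun x hx => ?_) h6.ge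
          obtain ⟨i, _, rfl⟩ := mem_image.1 hx
          have h7 : Equiv.swap u v (a i) ∈ S := h4 ▸ mem_image_of_mem _ (mem_univ i)
          rw [Equiv.swap_apply_def] at h7
          split_ifs at h7 <;> simp_all
        simp only [thetaCoeff, if_neg h1, if_neg h2]
        simp
  linarith

/-- Moving θ_x to its place in the increasing product moves it past the elements of S below x. These
are the crossings of {x} with the rest, so the recursion matches the sign in `superMul`. -/
theorem thetaCoeff_cons {m : ℕ} (x : ℕ) (a : Fin m → ℕ) (S : Finset ℕ) (hx : x ∈ S) :
    thetaCoeff (Fin.cons x a : Fin (m + 1) → ℕ) S =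
      (-1) ^ crossings {x} (S \ {x}) * thetaCoeff a (S \ {x}) := by
  have himg : univ.image (Fin.cons x a : Fin (m + 1) → ℕ) = insert x (univ.image a) := by
    ext y
    simp only [mem_image, mem_univ, true_and, mem_insert, Fin.exists_fin_succ, Fin.cons_zero,
      Fin.cons_succ, eq_comm]
  by_cases h : Function.Injective a ∧ univ.image a = S \ {x}
  · have hxa : x ∉ univ.image a := by simp [h.2]
    have h' : Function.Injective (Fin.cons x a : Fin (m + 1) → ℕ) ∧
        univ.image (Fin.cons x a : Fin (m + 1) → ℕ) = S := by
      refine ⟨Fin.cons_injective_iff.2 ⟨?_, h.1⟩, ?_⟩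
      · rintro ⟨i, hi⟩
        exact hxa (mem_image.2 ⟨i, mem_univ i, hi⟩)
      · rw [himg, h.2, insert_sdiff_self_of_mem hx]
    rw [thetaCoeff, thetaCoeff, if_pos h, if_pos h', neg_one_pow_inversions h.1,
      neg_one_pow_inversions h'.1, Fin.prod_univ_succ]
    congr 1
    · have h2 : crossings {x} (S \ {x}) = ((univ : Finset (Fin m)).filter (fun j => a j < x)).card := by
        rw [crossings, ← h.2, singleton_product, filter_map, card_map]
        simp only [Function.comp_def]
        rw [filter_image, card_image_of_injective _ h.1]
        rfl
      rw [h2, Fin.Ioi_zero_eq_map, prod_map]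
      simp only [Fin.coe_succEmb, Fin.cons_succ, Fin.cons_zero]
      rw [← prod_const, prod_filter]
      refine prod_congr rfl fun j _ => ?_
      have hne : a j ≠ x := fun h3 => hxa (mem_image.2 ⟨j, mem_univ j, h3⟩)
      split_ifs with h3
      · rw [sign_neg (by omega)]; simp
      · rw [sign_pos (by omega)]; simp
    · refine prod_congr rfl fun i _ => ?_
      rw [Fin.Ioi_succ, prod_map]
      simp
  · have h' : ¬ (Function.Injective (Fin.cons x a : Fin (m + 1) → ℕ) ∧
        univ.image (Fin.cons x a : Fin (m + 1) → ℕ) = S) := by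
      rintro ⟨h1, h2⟩
      rw [Fin.cons_injective_iff] at h1
      refine h ⟨h1.2, ?_⟩
      rw [← h2, himg, insert_sdiff_of_mem _ (mem_singleton_self x), sdiff_singleton_eq_erase,
        erase_eq_of_notMem]
      intro h3
      obtain ⟨i, _, hi⟩ := mem_image.1 h3
      exact h1.1 ⟨i, hi⟩
    rw [thetaCoeff, thetaCoeff, if_neg h, if_neg h', mul_zero]

/-! ### Products of odd and even factors in commuting superspace -/

theorem CFun.mul_val (f g : CFun) : (f * g).1 = superMul f.1 g.1 := rfl

theorem CFun.one_val : (1 : CFun).1 = superOne := rfl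

/-- Products of odd elements. -/
theorem CFun.prod_ofFn_odd {m : ℕ} (f : Fin m → CFun)
    (hf : ∀ i S, S.card ≠ 1 → (f i).1 S = 0) (S : Finset ℕ) :
    (List.ofFn f).prod.1 S =
      ∑ a ∈ Fintype.piFinset fun _ : Fin m => S, thetaCoeff a S • ∏ i, (f i).1 {a i} := by
  induction m generalizing S with
  | zero =>
    simp only [List.ofFn_zero, List.prod_nil, CFun.one_val, superOne]
    rw [Fintype.piFinset_of_isEmpty]
    simp [thetaCoeff, inversions, eq_comm, Function.injective_of_subsingleton]
  | succ m ih =>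
    rw [List.ofFn_succ, List.prod_cons, CFun.mul_val, superMul]
    -- The first factor is supported on singletons, so only the splittings S = {x} ∪ (S \ {x})
    -- survive in the product.
    have h1 : ∀ T ∈ S.powerset, T ∉ S.image (fun x => ({x} : Finset ℕ)) →
        (-1) ^ crossings T (S \ T) * ((f 0).1 T *
          (List.ofFn fun i : Fin m => f i.succ).prod.1 (S \ T)) = 0 := by
      intro T hT hT'
      rw [hf 0 T, zero_mul, mul_zero]
      intro h
      obtain ⟨x, rfl⟩ := card_eq_one.1 h
      exact hT' (mem_image.2 ⟨x, by simpa using hT, rfl⟩)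
    rw [← sum_subset (by
      intro T hT
      obtain ⟨x, hx, rfl⟩ := mem_image.1 hT
      simpa using hx) h1, sum_image fun x _ y _ h => by simpa using h]
    have h2 : ∀ x ∈ S, (-1) ^ crossings {x} (S \ {x}) * ((f 0).1 {x} *
          (List.ofFn fun i : Fin m => f i.succ).prod.1 (S \ {x})) =
        ∑ a ∈ Fintype.piFinset fun _ : Fin m => S,
          thetaCoeff (Fin.cons x a : Fin (m + 1) → ℕ) S •
            ∏ i, (f i).1 {(Fin.cons x a : Fin (m + 1) → ℕ) i} := by
      intro x hx
      rw [ih _ fun i => hf i.succ, mul_sum, mul_sum]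
      -- The tuples may range over all of S instead of S \ {x}: the extra ones repeat x after
      -- `Fin.cons`, so their θ-coefficient is 0.
      refine sum_subset_zero_on_sdiff (Fintype.piFinset_subset _ _ fun _ => sdiff_subset) ?_ ?_
      · intro a ha
        rw [thetaCoeff_cons _ _ _ hx]
        have : ¬ (Function.Injective a ∧ univ.image a = S \ {x}) := by
          rintro ⟨_, h⟩
          refine (mem_sdiff.1 ha).2 (Fintype.mem_piFinset.2 fun i => ?_)
          rw [← h]
          exact mem_image_of_mem _ (mem_univ i)
        simp [thetaCoeff, this]
      · intro a _
        rw [thetaCoeff_cons _ _ _ hx, Fin.prod_univ_succ]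
        simp only [Fin.cons_zero, Fin.cons_succ]
        rw [mul_smul_comm, mul_smul_comm, mul_smul]
        rw [smul_comm]
        congr 1
        rcases neg_one_pow_eq_or ℚ (crossings {x} (S \ {x})) with h | h
        · have h' : (-1 : MvPowerSeries ℕ ℚ) ^ crossings {x} (S \ {x}) = 1 := by
            have := congrArg (algebraMap ℚ (MvPowerSeries ℕ ℚ)) h
            simpa using this
          rw [h, h', one_smul, one_mul]
        · have h' : (-1 : MvPowerSeries ℕ ℚ) ^ crossings {x} (S \ {x}) = -1 := by
            have := congrArg (algebraMap ℚ (MvPowerSeries ℕ ℚ)) h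
            simpa using this
          rw [h, h', neg_smul, one_smul, neg_mul, one_mul]
    rw [sum_congr rfl h2, ← sum_product']
    refine sum_bij' (fun p _ => Fin.cons p.1 p.2) (fun a _ => (a 0, fun i => a i.succ))
      ?_ ?_ ?_ ?_ ?_
    · rintro ⟨x, a⟩ h
      simp only [mem_product, Fintype.mem_piFinset] at h ⊢
      exact Fin.cases h.1 h.2
    · intro a h
      simp only [mem_product, Fintype.mem_piFinset] at h ⊢
      exact ⟨h _, fun i => h _⟩
    · simp
    · intro a _
      exact Fin.cons_self_tail a
    · simp

theorem CFun.mul_even (f g : CFun) (hg : ∀ S, S ≠ ∅ → g.1 S = 0) (S : Finset ℕ) :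
    (f * g).1 S = f.1 S * g.1 ∅ := by
  rw [CFun.mul_val, superMul, sum_eq_single S]
  · simp [crossings]
  · intro T hT hne
    rw [hg, mul_zero, mul_zero]
    exact fun h => hne (Subset.antisymm (mem_powerset.1 hT) (sdiff_eq_empty_iff_subset.1 h))
  · simp

theorem CFun.list_prod_even (l : List CFun) (hl : ∀ g ∈ l, ∀ S, S ≠ ∅ → g.1 S = 0) :
    (∀ S, S ≠ ∅ → l.prod.1 S = 0) ∧ l.prod.1 ∅ = (l.map fun g => g.1 ∅).prod := by
  induction l with
  | nil =>
    refine ⟨fun S hS => ?_, ?_⟩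
    · simp [CFun.one_val, superOne, hS]
    · simp [CFun.one_val, superOne]
  | cons g l ih =>
    have h1 := ih fun g' hg' => hl g' (List.mem_cons_of_mem _ hg')
    refine ⟨fun S hS => ?_, ?_⟩
    · rw [List.prod_cons, CFun.mul_even _ _ h1.1, hl g List.mem_cons_self S hS, zero_mul]
    · rw [List.prod_cons, CFun.mul_even _ _ h1.1, h1.2, List.map_cons, List.prod_cons]

/-- The coefficients of the multiplicative functions `F_{Λ_1} ⋯ F_{Λ_m} G_{Λ_{m+1}} ⋯ G_{Λ_k}`. -/
theorem CFun.coeff_multiplicative {m : ℕ} (F G : ℕ → CFun)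
    (hF : ∀ k S, S.card ≠ 1 → (F k).1 S = 0) (hG : ∀ r S, S ≠ ∅ → (G r).1 S = 0)
    (u : Fin m → ℕ) (l : List ℕ) (S : Finset ℕ) (α : ℕ →₀ ℕ) :
    MvPowerSeries.coeff α (((List.ofFn fun i => F (u i)).prod * (l.map G).prod).1 S) =
      thetaSum (fun a => MvPowerSeries.coeff α
        ((∏ i, (F (u i)).1 {a i}) * (l.map fun r => (G r).1 ∅).prod)) S := by
  have h := CFun.list_prod_even (l.map G) (by
    intro g hg
    obtain ⟨r, _, rfl⟩ := List.mem_map.1 hg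
    exact hG r)
  rw [CFun.mul_even _ _ h.1, h.2, CFun.prod_ofFn_odd _ fun i => hF (u i), sum_mul, map_sum,
    List.map_map]
  refine sum_congr rfl fun a _ => ?_
  rw [smul_mul_assoc, map_smul, smul_eq_mul]
  rfl

/-! ### Words and their contents -/

/-- The exponent of the monomial `∏ j, x_{b_j}` in commuting variables. -/
def content {J : Type*} [Fintype J] (b : J → ℕ) : ℕ →₀ ℕ := ∑ j, Finsupp.single (b j) 1

section content

variable {J : Type*} [Fintype J]

theorem content_apply (b : J → ℕ) (v : ℕ) : content b v = (univ.filter fun j => b j = v).card := by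
  rw [content, Finsupp.finsetSum_apply, card_filter]
  simp only [Finsupp.single_apply]

theorem degree_content (b : J → ℕ) : (content b).degree = Fintype.card J := by
  simp [content, map_sum]

theorem support_content (b : J → ℕ) : (content b).support = univ.image b := by
  ext v
  rw [Finsupp.mem_support_iff, content_apply, Finset.card_ne_zero, mem_image]
  simp [Finset.Nonempty]

theorem mem_support_content (b : J → ℕ) (j : J) : b j ∈ (content b).support := by
  rw [support_content]
  exact mem_image_of_mem _ (mem_univ j)

theorem mem_piFinset_of_content [DecidableEq J] {b : J → ℕ} {α : ℕ →₀ ℕ} {V : Finset ℕ} (h : content b = α)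
    (hV : α.support ⊆ V) : b ∈ Fintype.piFinset fun _ => V :=
  Fintype.mem_piFinset.2 fun j => hV (h ▸ mem_support_content b j)

theorem toMultiset_content {n : ℕ} (b : Fin n → ℕ) :
    (content b).toMultiset = (List.ofFn b : Multiset ℕ) := by
  rw [content, map_sum]
  simp only [Finsupp.toMultiset_single, one_smul]
  rw [← Multiset.sum_map_singleton (List.ofFn b : Multiset ℕ), Multiset.map_coe, Multiset.sum_coe,
    List.map_ofFn, List.sum_ofFn]
  rfl

variable [DecidableEq J]

/-- The number of words with content `β`, times `∏ β_v!`. -/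
theorem card_content_eq {β : ℕ →₀ ℕ} {V : Finset ℕ} (hV : β.support ⊆ V)
    (hβ : β.degree = Fintype.card J) :
    (((Fintype.piFinset fun _ : J => V).filter fun b => content b = β).card) *
      ∏ v ∈ β.support, (β v).factorial = (Fintype.card J).factorial := by
  classical
  -- Expand the power (∑ x_v)^|J| in two ways, over words and by the multinomial theorem, and
  -- compare the coefficients of x^β.
  have h1 : ((∑ v ∈ V, MvPowerSeries.monomial (Finsupp.single v 1) (1 : ℚ)) ^ Fintype.card J) =
      ∑ b ∈ Fintype.piFinset fun _ : J => V, MvPowerSeries.monomial (content b) (1 : ℚ) := by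
    rw [← card_univ, ← prod_const, prod_univ_sum]
    refine sum_congr rfl fun b _ => ?_
    rw [MvPowerSeries.prod_monomial, prod_const_one]
    rfl
  have h2 := congrArg (MvPowerSeries.coeff β) h1
  rw [Finset.sum_pow_eq_sum_piAntidiag, map_sum, map_sum] at h2
  have h3 : ∀ k : ℕ → ℕ, (∏ i ∈ V, MvPowerSeries.monomial (Finsupp.single i 1) (1 : ℚ) ^ k i) =
      MvPowerSeries.monomial (∑ i ∈ V, Finsupp.single i (k i)) (1 : ℚ) := by
    intro k
    simp only [MvPowerSeries.monomial_pow, MvPowerSeries.prod_monomial]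
    simp
  have hsum : β = ∑ i ∈ V, Finsupp.single i (β i) := by
    conv_lhs => rw [← Finsupp.sum_single β]
    exact Finsupp.sum_of_support_subset _ hV _ (by simp)
  have hdeg : ∑ i ∈ V, β i = Fintype.card J := by
    rw [← hβ, Finsupp.degree_apply]
    exact (sum_subset hV (by simp)).symm
  have h4 : ∑ k ∈ V.piAntidiag (Fintype.card J), MvPowerSeries.coeff β
      ((Nat.multinomial V k : MvPowerSeries ℕ ℚ) *
        ∏ i ∈ V, MvPowerSeries.monomial (Finsupp.single i 1) (1 : ℚ) ^ k i) =
      Nat.multinomial V β := by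
    rw [sum_eq_single (β : ℕ → ℕ)]
    · rw [h3, ← hsum, ← map_natCast (MvPowerSeries.C (σ := ℕ) (R := ℚ)), MvPowerSeries.coeff_C_mul,
        MvPowerSeries.coeff_monomial, if_pos rfl, mul_one]
    · intro k hk hne
      rw [h3, ← map_natCast (MvPowerSeries.C (σ := ℕ) (R := ℚ)), MvPowerSeries.coeff_C_mul,
        MvPowerSeries.coeff_monomial, if_neg, mul_zero]
      intro h
      apply hne
      funext v
      rw [h, Finsupp.finsetSum_apply]
      rw [mem_piAntidiag] at hk
      by_cases hv : v ∈ V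
      · rw [sum_eq_single v] <;> simp +contextual [hv]
      · have := mt (hk.2 v) hv
        rw [not_not] at this
        rw [this]
        symm
        refine sum_eq_zero fun i hi => ?_
        rw [Finsupp.single_apply, if_neg]
        rintro rfl
        exact hv hi
    · intro h
      refine absurd (mem_piAntidiag.2 ⟨hdeg, fun i hi => hV (Finsupp.mem_support_iff.2 hi)⟩) h
  rw [h4] at h2
  simp only [MvPowerSeries.coeff_monomial] at h2
  rw [sum_boole] at h2
  have h5 := Nat.multinomial_spec V β
  rw [hdeg] at h5
  rw [← h5, mul_comm]
  congr 1
  · refine prod_subset hV fun v _ hv => ?_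
    rw [Finsupp.notMem_support_iff.1 hv, Nat.factorial_zero]
  · have h7 := (Nat.cast_inj (R := ℚ)).1 h2
    rw [h7]
    congr 1
    exact filter_congr fun b _ => eq_comm

/-- `∏ α_v!`. -/
def expFactorial (α : ℕ →₀ ℕ) : ℕ := ∏ v ∈ α.support, (α v).factorial

theorem expFactorial_ne_zero (α : ℕ →₀ ℕ) : (expFactorial α : ℚ) ≠ 0 := by
  rw [Nat.cast_ne_zero]
  exact prod_ne_zero_iff.2 fun v _ => Nat.factorial_ne_zero _

/-- All words with content β contribute the same amount w β, and there are |J|!/β! of them. -/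
theorem coeff_sum_monomial_content (w : (ℕ →₀ ℕ) → ℚ) {β : ℕ →₀ ℕ} {V : Finset ℕ}
    (hV : β.support ⊆ V) :
    MvPowerSeries.coeff β (∑ b ∈ Fintype.piFinset fun _ : J => V,
      MvPowerSeries.monomial (content b) (w (content b))) =
    if β.degree = Fintype.card J then
      w β * ((Fintype.card J).factorial / expFactorial β) else 0 := by
  classical
  rw [map_sum]
  simp only [MvPowerSeries.coeff_monomial]
  rw [← sum_filter]
  split_ifs with h
  · have h1 := card_content_eq (J := J) hV h
    rw [← h1, Nat.cast_mul, ← expFactorial, mul_div_cancel_right₀ _ (expFactorial_ne_zero β)]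
    rw [sum_congr (g := fun _ => w β) (filter_congr fun b _ => eq_comm)
      fun b hb => by rw [(mem_filter.1 hb).2]]
    rw [sum_const, nsmul_eq_mul, mul_comm]
  · refine sum_eq_zero fun b hb => absurd ?_ h
    rw [(mem_filter.1 hb).2, degree_content]

end content

/-- The coefficient of x^α in a product sees only exponents β ≤ α of the factors. This is what
allows the finite sums over words in the support of α to be replaced by series in all variables. -/
theorem coeff_prod_congr {ι : Type*} (s : Finset ι) (P Q : ι → MvPowerSeries ℕ ℚ) (α : ℕ →₀ ℕ)
    (h : ∀ t ∈ s, ∀ β ≤ α, MvPowerSeries.coeff β (P t) = MvPowerSeries.coeff β (Q t)) :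
    MvPowerSeries.coeff α (∏ t ∈ s, P t) = MvPowerSeries.coeff α (∏ t ∈ s, Q t) := by
  classical
  rw [MvPowerSeries.coeff_prod, MvPowerSeries.coeff_prod]
  refine sum_congr rfl fun l hl => prod_congr rfl fun t ht => h t ht _ ?_
  rw [← (mem_finsuppAntidiag.1 hl).1]
  exact single_le_sum (f := fun t => l t) (fun _ _ => zero_le) ht

/-! ### Coefficients of the projection -/

theorem coeff_rho (f : NCFun) (S : Finset ℕ) (α : ℕ →₀ ℕ) :
    MvPowerSeries.coeff α ((rho f).1 S) = ∑ w ∈ α.toMultiset.lists.toFinset, f.1 S w := rfl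

/-- The words that are rearrangements of the multiset of α are exactly those with content α, and
each b contributes to just one word. -/
theorem coeff_rho_ncSum {n m : ℕ} (c : (Fin m → ℕ) → (Fin n → ℕ) → ℚ) (S : Finset ℕ)
    (α : ℕ →₀ ℕ) :
    MvPowerSeries.coeff α ((rho (ncSum c)).1 S) =
      thetaSum (fun a => ∑ b ∈ Fintype.piFinset fun _ : Fin n => α.support,
        if content b = α then c a b else 0) S := by
  rw [coeff_rho]
  have h1 : ∀ w ∈ α.toMultiset.lists.toFinset, (ncSum c).1 S w =
      ∑ a ∈ Fintype.piFinset fun _ : Fin m => S,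
        ∑ b ∈ Fintype.piFinset fun _ : Fin n => α.support,
          c a b * (thetaCoeff a S * if List.ofFn b = w then 1 else 0) := by
    intro w hw
    have h2 : α.toMultiset = (w : Multiset ℕ) := by
      simpa [Multiset.mem_lists_iff] using hw
    have h3 : w.toFinset = α.support := by
      rw [← Finsupp.toFinset_toMultiset, h2]
      rfl
    rw [← h3]
    rfl
  rw [sum_congr rfl h1, sum_comm]
  refine sum_congr rfl fun a _ => ?_
  rw [sum_comm, mul_sum]
  refine sum_congr rfl fun b _ => ?_
  rw [← mul_sum, ← mul_sum, sum_ite_eq]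
  have h4 : (List.ofFn b ∈ α.toMultiset.lists.toFinset) ↔ content b = α := by
    rw [Multiset.mem_toFinset, Multiset.mem_lists_iff, 
      ← (Function.LeftInverse.injective Finsupp.toMultiset_toFinsupp).eq_iff,
      toMultiset_content, eq_comm]
    rfl
  by_cases h5 : content b = α
  · rw [if_pos (h4.2 h5), if_pos h5]
    ring
  · rw [if_neg (mt h4.1 h5), if_neg h5]
    ring

/-! ### Splitting words along the blocks of K -/

namespace SetSupercomp

variable {n m : ℕ} (K : SetSupercomp n m)

/-- The blocks, without `0`. -/
def block : Fin m ⊕ {B // B ∈ K.bos} → Finset (Fin n) := Sum.elim K.ferm Subtype.val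

theorem exists_mem_block (x : Fin n) : ∃ t, x ∈ K.block t := by
  rcases K.cover x with ⟨i, hi⟩ | ⟨B, hB, hx⟩
  · exact ⟨Sum.inl i, hi⟩
  · exact ⟨Sum.inr ⟨B, hB⟩, hx⟩

theorem block_unique {x : Fin n} {t u : Fin m ⊕ {B // B ∈ K.bos}} (ht : x ∈ K.block t)
    (hu : x ∈ K.block u) : t = u := by
  rcases t with i | ⟨B, hB⟩ <;> rcases u with j | ⟨C, hC⟩ <;>
    simp only [block, Sum.elim_inl, Sum.elim_inr] at ht hu
  · by_contra h
    exact disjoint_left.1 (K.ferm_disjoint i j fun h' => h (by rw [h'])) ht hu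
  · exact absurd hu (disjoint_left.1 (K.ferm_bos_disjoint i C hC) ht)
  · exact absurd ht (disjoint_left.1 (K.ferm_bos_disjoint j B hB) hu)
  · by_contra h
    exact disjoint_left.1 (K.bos_disjoint B hB C hC fun h' => h (by subst h'; rfl)) ht hu

/-- The block that contains `x`. -/
def idx (x : Fin n) : Fin m ⊕ {B // B ∈ K.bos} := (K.exists_mem_block x).choose

theorem mem_block_idx (x : Fin n) : x ∈ K.block (K.idx x) := (K.exists_mem_block x).choose_spec

theorem mem_block {x : Fin n} {t : Fin m ⊕ {B // B ∈ K.bos}} : x ∈ K.block t ↔ K.idx x = t :=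
  ⟨fun h => K.block_unique (K.mem_block_idx x) h, fun h => h ▸ K.mem_block_idx x⟩

theorem sameBlock_iff {x y : Fin n} : K.SameBlock x y ↔ K.idx x = K.idx y := by
  rw [← K.mem_block]
  constructor
  · rintro (⟨t, h1, h2⟩ | ⟨B, hB, h1, h2⟩)
    · exact (K.mem_block (t := Sum.inl t)).1 h2 ▸ h1
    · exact (K.mem_block (t := Sum.inr ⟨B, hB⟩)).1 h2 ▸ h1
  · intro h
    rcases h' : K.idx y with i | ⟨B, hB⟩
    · have h1 := h' ▸ h
      have h2 := h' ▸ K.mem_block_idx y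
      exact Or.inl ⟨i, h1, h2⟩
    · have h1 := h' ▸ h
      have h2 := h' ▸ K.mem_block_idx y
      exact Or.inr ⟨B, hB, h1, h2⟩

/-- The content of the restriction of `b` to a block. -/
def blockContent (b : Fin n → ℕ) (t : Fin m ⊕ {B // B ∈ K.bos}) : ℕ →₀ ℕ :=
  content fun j : K.block t => b j

theorem blockContent_apply (b : Fin n → ℕ) (t : Fin m ⊕ {B // B ∈ K.bos}) (v : ℕ) :
    K.blockContent b t v = ((K.block t).filter fun j => b j = v).card := by
  rw [blockContent, content_apply]
  refine card_bij' (fun j _ => (j : Fin n)) (fun j hj => ⟨j, (mem_filter.1 hj).1⟩) ?_ ?_ ?_ ?_ <;>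
    simp

/-- Restriction to the blocks identifies words on [n] with tuples of words on the blocks, and
contents add up. Expanding the product of the block sums therefore gives the sum over all words. -/
theorem sum_prod_block (V : Finset ℕ) (w : Fin m ⊕ {B // B ∈ K.bos} → (ℕ →₀ ℕ) → ℚ)
    (α : ℕ →₀ ℕ) :
    ∑ b ∈ Fintype.piFinset fun _ : Fin n => V,
      (if content b = α then ∏ t, w t (K.blockContent b t) else 0) =
    MvPowerSeries.coeff α (∏ t, ∑ b ∈ Fintype.piFinset fun _ : K.block t => V,
      MvPowerSeries.monomial (content b) (w t (content b))) := by
  classical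
  rw [prod_univ_sum, map_sum]
  refine sum_bij' (fun b _ t j => b j) (fun x _ j => x (K.idx j) ⟨j, K.mem_block_idx j⟩)
    ?_ ?_ ?_ ?_ ?_
  · intro b hb
    simp only [Fintype.mem_piFinset] at hb ⊢
    exact fun t j => hb j
  · intro x hx
    simp only [Fintype.mem_piFinset] at hx ⊢
    exact fun j => hx _ _
  · intro b _
    rfl
  · intro x _
    funext t ⟨j, hj⟩
    obtain rfl := K.mem_block.1 hj
    rfl
  · intro b _
    rw [MvPowerSeries.prod_monomial, MvPowerSeries.coeff_monomial]
    have h : ∑ t, content (fun j : K.block t => b j) = content b := by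
      simp only [content]
      rw [← sum_fiberwise univ K.idx fun j => Finsupp.single (b j) 1]
      refine sum_congr rfl fun t _ => ?_
      rw [sum_coe_sort (K.block t) fun j => Finsupp.single (b j) 1]
      refine sum_congr ?_ fun _ _ => rfl
      ext j
      simp [K.mem_block]
    rw [h]
    simp only [eq_comm (a := α)]
    rfl

end SetSupercomp

/-! ### Functions whose coefficients are products over blocks -/

/-- The functions `F_k = ∑_x θ_x φ_k(x)` and `G_r` in commuting variables have, up to factors
`s_k`, the coefficients of the images of the functions in noncommuting variables with the
coefficients `f x (content b)` and `g (content b)`. -/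
structure BlockData where
  F : ℕ → CFun
  G : ℕ → CFun
  s : ℕ → ℚ
  f : ℕ → (ℕ →₀ ℕ) → ℚ
  g : (ℕ →₀ ℕ) → ℚ
  F_odd : ∀ k S, S.card ≠ 1 → (F k).1 S = 0
  G_even : ∀ r S, S ≠ ∅ → (G r).1 S = 0
  F_coeff : ∀ k x β, s k * MvPowerSeries.coeff β ((F k).1 {x}) =
    if β.degree = k then f x β * (k.factorial / expFactorial β) else 0
  -- Positivity matters: `cPowerSum 0` is 0, whereas the empty word would call for the constant
  -- coefficient 1. Nonfermionic blocks are nonempty, so r = 0 never arises.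
  G_coeff : ∀ r, 0 < r → ∀ β, s r * MvPowerSeries.coeff β ((G r).1 ∅) =
    if β.degree = r then g β * (r.factorial / expFactorial β) else 0

namespace BlockData

variable {n m : ℕ} (D : BlockData)

/-- The product of the coefficients of all blocks. -/
def weight (K : SetSupercomp n m) (a : Fin m → ℕ) (b : Fin n → ℕ) : ℚ :=
  (∏ i, D.f (a i) (K.blockContent b (Sum.inl i))) *
    ∏ B : {B // B ∈ K.bos}, D.g (K.blockContent b (Sum.inr B))

/-- The sum over words splits into one sum for each block, and `F_coeff` and `G_coeff` identify each
of these with the scaled series of that block, as far as exponents below α are concerned. -/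
theorem sum_weight (K : SetSupercomp n m) (a : Fin m → ℕ) (α : ℕ →₀ ℕ) :
    ∑ b ∈ Fintype.piFinset fun _ : Fin n => α.support,
      (if content b = α then D.weight K a b else 0) =
    ((∏ i, D.s (K.ferm i).card) * ∏ B ∈ K.bos, D.s B.card) *
      MvPowerSeries.coeff α ((∏ i, (D.F (K.ferm i).card).1 {a i}) *
        ∏ B ∈ K.bos, (D.G B.card).1 ∅) := by
  have h1 : ∀ b, D.weight K a b = ∏ t, Sum.elim (fun i => D.f (a i)) (fun _ => D.g) t
      (K.blockContent b t) := by
    intro b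
    rw [Fintype.prod_sum_type]
    rfl
  simp only [h1]
  rw [K.sum_prod_block, ← prod_coe_sort K.bos fun B => D.s B.card,
    ← prod_coe_sort K.bos fun B => (D.G B.card).1 ∅]
  refine Eq.trans ?_ (map_smul (MvPowerSeries.coeff α) _ _)
  have h2 : ((∏ i, D.s (K.ferm i).card) * ∏ B : {B // B ∈ K.bos}, D.s B.1.card) •
      ((∏ i, (D.F (K.ferm i).card).1 {a i}) * ∏ B : {B // B ∈ K.bos}, (D.G B.1.card).1 ∅) =
      ∏ t, Sum.elim (fun i => D.s (K.ferm i).card • (D.F (K.ferm i).card).1 {a i})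
        (fun B : {B // B ∈ K.bos} => D.s B.1.card • (D.G B.1.card).1 ∅) t := by
    rw [Fintype.prod_sum_type]
    simp only [Sum.elim_inl, Sum.elim_inr, MvPowerSeries.smul_eq_C_mul, prod_mul_distrib, map_mul,
      map_prod]
    ring
  rw [h2]
  refine coeff_prod_congr _ _ _ _ ?_
  rintro t - β hβ
  have hV : β.support ⊆ α.support := Finsupp.support_mono hβ
  rcases t with i | B
  · simp only [Sum.elim_inl]
    rw [coeff_sum_monomial_content _ hV, map_smul, smul_eq_mul, D.F_coeff, Fintype.card_coe]
    rfl
  · simp only [Sum.elim_inr]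
    rw [coeff_sum_monomial_content _ hV, map_smul, smul_eq_mul,
      D.G_coeff _ (card_pos.2 (K.bos_nonempty _ B.2)), Fintype.card_coe]
    rfl

end BlockData

/-! ### The sorting permutation and its sign -/

namespace SetSuperpartition

variable {n m : ℕ} (I : SetSuperpartition n m)

/-- The permutation that sorts the sizes of the fermionic blocks in decreasing order. -/
def sortPerm : Equiv.Perm (Fin m) := Fin.revPerm.trans (Tuple.sort I.fermSize)

theorem type_sym (h : Function.Injective I.fermSize) :
    ((I.type h).sym : Multiset ℕ) = I.bos.val.map Finset.card :=
  Multiset.sort_eq _ _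

/-- As the sizes are distinct, any list of transpositions that sorts them has product `sortPerm`.
Hence the parity of its length is forced, whatever the minimum is. -/
theorem neg_one_pow_eps (h : Function.Injective I.fermSize) :
    (-1 : ℚ) ^ I.eps h = ((Equiv.Perm.sign I.sortPerm : ℤ) : ℚ) := by
  -- The infimum of an empty set would be the default value 0; a factorization of `sortPerm` into
  -- transpositions shows that it is attained.
  have hne : {k | ∃ l : List (Equiv.Perm (Fin m)), l.length = k ∧ (∀ τ ∈ l, τ.IsSwap) ∧
      I.fermSize ∘ l.prod = (I.type h).anti}.Nonempty := by
    obtain ⟨l, hl, hs⟩ := (Equiv.Perm.truncSwapFactors I.sortPerm).out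
    refine ⟨l.length, l, rfl, hs, ?_⟩
    rw [hl]
    rfl
  obtain ⟨l, hl, hs, hp⟩ := Nat.sInf_mem hne
  have h1 : l.prod = I.sortPerm := by
    ext i
    exact congrArg _ (h (congrFun hp i))
  rw [← h1, Equiv.Perm.sign_prod_list_swap hs, hl]
  simp [eps]

theorem prod_bos_eq {R : Type*} [CommMonoid R] (h : Function.Injective I.fermSize) (f : ℕ → R) :
    ∏ B ∈ I.bos, f B.card = ((I.type h).sym.map f).prod := by
  rw [← Multiset.prod_coe, ← Multiset.map_coe, type_sym, Multiset.map_map]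
  rfl

theorem prod_ferm_eq {R : Type*} [CommMonoid R] (h : Function.Injective I.fermSize)
    (f : ℕ → Fin m → R) :
    ∏ i, f (I.ferm i).card i = ∏ i, f ((I.type h).anti i) (I.sortPerm i) :=
  (Equiv.prod_comp I.sortPerm fun i => f (I.ferm i).card i).symm

theorem card_ferm_swap {i j : Fin m} (hs : I.fermSize i = I.fermSize j) (k : Fin m) :
    (I.ferm (Equiv.swap i j k)).card = (I.ferm k).card := by
  change I.fermSize _ = I.fermSize _
  rw [Equiv.swap_apply_def]
  split_ifs with h2 h3
  · rw [h2, hs]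
  · rw [h3, hs]
  · rfl

end SetSuperpartition

theorem CFun.ext_coeff {f g : CFun}
    (h : ∀ S α, MvPowerSeries.coeff α (f.1 S) = MvPowerSeries.coeff α (g.1 S)) : f = g :=
  Subtype.ext (funext fun S => MvPowerSeries.ext fun α => h S α)

theorem CFun.coeff_smul (c : ℚ) (f : CFun) (S : Finset ℕ) (α : ℕ →₀ ℕ) :
    MvPowerSeries.coeff α ((c • f).1 S) = c * MvPowerSeries.coeff α (f.1 S) := rfl

theorem CFun.coeff_zero (S : Finset ℕ) (α : ℕ →₀ ℕ) :
    MvPowerSeries.coeff α ((0 : CFun).1 S) = 0 := rfl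

namespace BlockData

variable {n m : ℕ} (D : BlockData) (I : SetSuperpartition n m)

/-- Both sides are alternating sums of the same product of series. The sizes are in block order on
one side and in decreasing order on the other, and reindexing a by `sortPerm` yields the sign. -/
theorem eq_smul (h : Function.Injective I.fermSize) (R : CFun)
    (hR : ∀ S α, MvPowerSeries.coeff α (R.1 S) = thetaSum (fun a =>
      ∑ b ∈ Fintype.piFinset fun _ : Fin n => α.support,
        if content b = α then D.weight I.toSetSupercomp a b else 0) S) :
    R = ((-1 : ℚ) ^ I.eps h * ((∏ i, D.s ((I.type h).anti i)) *
        ((I.type h).sym.map D.s).prod)) •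
      ((List.ofFn fun i => D.F ((I.type h).anti i)).prod * ((I.type h).sym.map D.G).prod) := by
  refine CFun.ext_coeff fun S α => ?_
  rw [hR, CFun.coeff_smul, CFun.coeff_multiplicative D.F D.G D.F_odd D.G_even,
    I.neg_one_pow_eps h, mul_assoc, ← thetaSum_mul_left, ← thetaSum_comp_perm]
  congr 1
  funext a
  rw [sum_weight, I.prod_bos_eq h, I.prod_bos_eq h fun k => (D.G k).1 ∅,
    I.prod_ferm_eq h fun k _ => D.s k, I.prod_ferm_eq h fun k i => (D.F k).1 {a i}]
  rfl

/-- After summing over words only the sizes of the blocks matter, so exchanging the θ-indices of two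
fermionic blocks of equal size leaves the inner sum unchanged. -/
theorem eq_zero (h : ∃ i j : Fin m, i ≠ j ∧ I.fermSize i = I.fermSize j) (R : CFun)
    (hR : ∀ S α, MvPowerSeries.coeff α (R.1 S) = thetaSum (fun a =>
      ∑ b ∈ Fintype.piFinset fun _ : Fin n => α.support,
        if content b = α then D.weight I.toSetSupercomp a b else 0) S) :
    R = 0 := by
  obtain ⟨i, j, hij, hs⟩ := h
  refine CFun.ext_coeff fun S α => ?_
  rw [hR, CFun.coeff_zero]
  refine thetaSum_eq_zero hij fun a => ?_
  rw [sum_weight, sum_weight]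
  congr 3
  rw [← Equiv.prod_comp (Equiv.swap i j) fun k => (D.F (I.ferm k).card).1 {a k}]
  refine prod_congr rfl fun k _ => ?_
  rw [I.card_ferm_swap hs]
  rfl

end BlockData

/-! ### Monomial functions: counting placements of the exponents -/

/-- The product of the factorials of the multiplicities. -/
def multFactorial (M : Multiset ℕ) : ℕ := ∏ r ∈ M.toFinset, (M.count r).factorial

section equivs

variable {A B : Type*} [Fintype A] [Fintype B]

theorem exists_equiv_comp_eq {f : A → ℕ} {g : B → ℕ}
    (h : univ.val.map f = univ.val.map g) : ∃ e : A ≃ B, ∀ a, g (e a) = f a := by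
  have h1 : ∀ v, Fintype.card {a // f a = v} = Fintype.card {b // g b = v} := by
    intro v
    have h2 := congrArg (Multiset.count v) h
    rw [Multiset.count_map, Multiset.count_map] at h2
    rw [Fintype.card_subtype, Fintype.card_subtype]
    simpa [card_def, filter_val, eq_comm] using h2
  refine ⟨((Equiv.sigmaFiberEquiv f).symm.trans
    (Equiv.sigmaCongrRight fun v => Fintype.equivOfCardEq (h1 v))).trans
    (Equiv.sigmaFiberEquiv g), fun a => ?_⟩
  exact (Fintype.equivOfCardEq (h1 (f a)) ⟨a, rfl⟩).2

theorem map_eq_of_equiv {f : A → ℕ} {g : B → ℕ} (e : A ≃ B) (h : ∀ a, g (e a) = f a) :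
    univ.val.map f = univ.val.map g := by
  rw [← univ_map_equiv_to_embedding e, map_val, Multiset.map_map]
  exact Multiset.map_congr rfl fun a _ => (h a).symm

/-- Once one value-preserving bijection exists, the others differ from it by the permutations that
stabilize f. Their number is the product of the factorials of the fiber sizes. -/
theorem card_equiv_comp_eq [DecidableEq A] [DecidableEq B] (f : A → ℕ) (g : B → ℕ) :
    Fintype.card {e : A ≃ B // ∀ a, g (e a) = f a} =
      if univ.val.map f = univ.val.map g then multFactorial (univ.val.map f) else 0 := by
  split_ifs with h
  · obtain ⟨e₀, he₀⟩ := exists_equiv_comp_eq h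
    have h1 : Fintype.card {e : A ≃ B // ∀ a, g (e a) = f a} =
        Fintype.card {σ : Equiv.Perm A // f ∘ σ = f} := by
      refine Fintype.card_congr
        ⟨fun e => ⟨e.1.trans e₀.symm, funext fun a => ?_⟩,
          fun σ => ⟨σ.1.trans e₀, fun a => ?_⟩, fun e => ?_, fun σ => ?_⟩
      · rw [← e.2 a, Function.comp, ← he₀]
        simp
      · rw [Equiv.trans_apply, he₀]
        exact congrFun σ.2 a
      · ext a
        simp
      · ext a
        simp
    rw [h1, DomMulAct.stabilizer_card', multFactorial, Multiset.toFinset_map, val_toFinset]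
    refine prod_congr rfl fun v _ => ?_
    rw [Multiset.count_map, Fintype.card_subtype, card_def, filter_val]
    simp only [eq_comm]
  · rw [Fintype.card_eq_zero_iff]
    exact ⟨fun e => h (map_eq_of_equiv e.1 e.2)⟩

end equivs

/-- The multiset of the exponents of the variables that are not in `T`. -/
def otherExponents (α : ℕ →₀ ℕ) (T : Finset ℕ) : Multiset ℕ := (α.support \ T).val.map α

theorem otherExponents_eq (α : ℕ →₀ ℕ) (T : Finset ℕ) :
    otherExponents α T = univ.val.map fun v : {v // v ∈ α.support \ T} => α v := by
  rw [otherExponents]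
  conv_lhs => rw [← attach_map_val (s := α.support \ T), map_val, Multiset.map_map]
  rfl

section place

variable {m : ℕ} {B : Type*} [Fintype B]

/-- Placing the exponents `k` on the indices `a`, and the positive exponents `k'` on further
different indices `y`, amounts to a bijection of the latter with the rest of the support. -/
theorem injective_and_sum_single_iff {a : Fin m → ℕ} (ha : Function.Injective a) (y : B → ℕ)
    (k : Fin m → ℕ) {k' : B → ℕ} (hk' : ∀ t, 0 < k' t) (α : ℕ →₀ ℕ) :
    (Function.Injective (Sum.elim a y) ∧
      ∑ i, Finsupp.single (a i) (k i) + ∑ t, Finsupp.single (y t) (k' t) = α) ↔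
    (∀ i, α (a i) = k i) ∧ ∃ e : B ≃ {v // v ∈ α.support \ univ.image a},
      (∀ t, α (e t) = k' t) ∧ ∀ t, (e t : ℕ) = y t := by
  constructor
  · rintro ⟨hinj, hα⟩
    have hya : ∀ i t, a i ≠ y t := fun i t h => by
      simpa using hinj (a₁ := Sum.inl i) (a₂ := Sum.inr t) h
    have hy : Function.Injective y := fun s t h => by
      simpa using hinj (a₁ := Sum.inr s) (a₂ := Sum.inr t) h
    have h1 : ∀ i, α (a i) = k i := by
      intro i
      rw [← hα, Finsupp.add_apply, Finsupp.finsetSum_apply, Finsupp.finsetSum_apply,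
        sum_eq_single i, sum_eq_zero]
      · simp
      · intro t _
        rw [Finsupp.single_apply, if_neg (hya i t).symm]
      · intro j _ hj
        rw [Finsupp.single_apply, if_neg fun h => hj (ha h)]
      · simp
    have h2 : ∀ t, α (y t) = k' t := by
      intro t
      rw [← hα, Finsupp.add_apply, Finsupp.finsetSum_apply, Finsupp.finsetSum_apply, sum_eq_zero,
        sum_eq_single t]
      · simp
      · intro s _ hs
        rw [Finsupp.single_apply, if_neg fun h => hs (hy h)]
      · simp
      · intro i _
        rw [Finsupp.single_apply, if_neg (hya i t)]
    -- Here the positivity of k' is needed. The exponents k at the indices a may be 0, so those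
    -- indices need not lie in the support.
    have h3 : ∀ t, y t ∈ α.support \ univ.image a := by
      intro t
      rw [mem_sdiff, Finsupp.mem_support_iff, h2, mem_image]
      exact ⟨(hk' t).ne', fun ⟨i, _, hi⟩ => hya i t hi⟩
    refine ⟨h1, Equiv.ofBijective (fun t => ⟨y t, h3 t⟩) ⟨fun s t h => hy (by simpa using h), ?_⟩,
      h2, fun t => rfl⟩
    rintro ⟨v, hv⟩
    rw [mem_sdiff, Finsupp.mem_support_iff] at hv
    by_contra hne
    apply hv.1
    rw [← hα, Finsupp.add_apply, Finsupp.finsetSum_apply, Finsupp.finsetSum_apply, sum_eq_zero,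
      sum_eq_zero, add_zero]
    · intro t _
      rw [Finsupp.single_apply, if_neg]
      exact fun h => hne ⟨t, Subtype.ext h⟩
    · intro i _
      rw [Finsupp.single_apply, if_neg]
      exact fun h => hv.2 (mem_image.2 ⟨i, mem_univ i, h⟩)
  · rintro ⟨h1, e, h2, h3⟩
    have hya : ∀ i t, a i ≠ y t := by
      intro i t h
      have h4 := (e t).2
      rw [h3, ← h, mem_sdiff] at h4
      exact h4.2 (mem_image_of_mem _ (mem_univ i))
    have hy : Function.Injective y := by
      intro s t h
      rw [← h3, ← h3] at h
      exact e.injective (Subtype.ext h)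
    refine ⟨?_, ?_⟩
    · rintro (i | s) (j | t) h
      · exact congrArg _ (ha h)
      · exact absurd h (hya i t)
      · exact absurd h.symm (hya j s)
      · exact congrArg _ (hy h)
    · ext v
      rw [Finsupp.add_apply, Finsupp.finsetSum_apply, Finsupp.finsetSum_apply]
      by_cases hv : v ∈ univ.image a
      · obtain ⟨i, _, rfl⟩ := mem_image.1 hv
        rw [h1, sum_eq_single i, sum_eq_zero]
        · simp
        · intro t _
          rw [Finsupp.single_apply, if_neg (hya i t).symm]
        · intro j _ hj
          rw [Finsupp.single_apply, if_neg fun h => hj (ha h)]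
        · simp
      · rw [sum_eq_zero, zero_add]
        · by_cases hs : v ∈ α.support
          · obtain ⟨t, ht⟩ := e.surjective ⟨v, mem_sdiff.2 ⟨hs, hv⟩⟩
            have hvt : y t = v := by rw [← h3, ht]
            subst hvt
            rw [sum_eq_single t]
            · rw [Finsupp.single_eq_same, ← h2, h3]
            · intro s _ hs
              rw [Finsupp.single_apply, if_neg fun h => hs (hy h)]
            · simp
          · rw [Finsupp.notMem_support_iff.1 hs]
            refine sum_eq_zero fun t _ => ?_
            rw [Finsupp.single_apply, if_neg]
            rintro rfl
            have h4 := (e t).2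
            rw [h3, mem_sdiff] at h4
            exact hs h4.1
        · intro i _
          rw [Finsupp.single_apply, if_neg]
          rintro rfl
          exact hv (mem_image_of_mem _ (mem_univ i))

end place

variable {n m : ℕ}

/-- The choice of the indices j is irrelevant: for a given α, whether a term with θ-indices a exists
depends only on the exponents at a and on the multiset of the others. -/
theorem exists_expo_eq_iff (Λ : Superpartition n m) {a : Fin m → ℕ} (ha : Function.Injective a)
    (α : ℕ →₀ ℕ) :
    (∃ j : Fin Λ.sym.length → ℕ, Function.Injective (Sum.elim a j) ∧ expo Λ a j = α) ↔
      (∀ i, α (a i) = Λ.anti i) ∧ otherExponents α (univ.image a) = Λ.sym := by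
  have hpos : ∀ t, 0 < Λ.sym.get t := fun t => Λ.sym_pos _ (List.get_mem _ _)
  have hsym : (Λ.sym : Multiset ℕ) = univ.val.map Λ.sym.get := by
    rw [Fin.univ_val_map, List.ofFn_get]
  simp only [expo, injective_and_sum_single_iff ha _ Λ.anti hpos, exists_and_left]
  refine and_congr_right fun _ => ?_
  rw [hsym, otherExponents_eq]
  constructor
  · rintro ⟨j, e, h1, h2⟩
    exact (map_eq_of_equiv e h1).symm
  · intro h
    obtain ⟨e, he⟩ := exists_equiv_comp_eq h.symm
    exact ⟨fun t => e t, e, he, fun t => rfl⟩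

-- A term of m_Λ that involves θ_S x^α is determined by its θ-indices a, so the sum over the set of
-- different terms becomes a sum over tuples, with no multiplicities.
open Classical in
theorem coeff_cMonomial (Λ : Superpartition n m) (S : Finset ℕ) (α : ℕ →₀ ℕ) :
    MvPowerSeries.coeff α ((cMonomial Λ).1 S) = thetaSum (fun a =>
      if (∀ i, α (a i) = Λ.anti i) ∧ otherExponents α (univ.image a) = Λ.sym then 1 else 0) S := by
  change ∑ᶠ t ∈ cTerms Λ, MvPowerSeries.coeff α (t S) = _
  set P : (Fin m → ℕ) → Prop := fun a =>
    (∀ i, α (a i) = Λ.anti i) ∧ otherExponents α (univ.image a) = Λ.sym with hP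
  set Q : Finset (Fin m → ℕ) := (Fintype.piFinset fun _ : Fin m => S).filter fun a =>
    (Function.Injective a ∧ univ.image a = S) ∧ P a with hQ
  have hcoeff : ∀ a : Fin m → ℕ, MvPowerSeries.coeff α (cTerm a α S) = thetaCoeff a S := by
    intro a
    simp [cTerm]
  rw [finsum_mem_eq_sum_of_inter_support_eq (t := Q.image fun a => cTerm a α), sum_image]
  · rw [thetaSum, hQ, sum_filter]
    refine sum_congr rfl fun a _ => ?_
    rw [hcoeff]
    by_cases h1 : Function.Injective a ∧ univ.image a = S
    · by_cases h2 : P a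
      · rw [if_pos ⟨h1, h2⟩, if_pos h2, mul_one]
      · rw [if_neg fun h => h2 h.2, if_neg h2, mul_zero]
    · rw [if_neg fun h => h1 h.1, thetaCoeff, if_neg h1, zero_mul]
  -- Different tuples cannot give the same term: both enumerate S so that α takes the values Λ^a,
  -- and these are pairwise distinct.
  · intro a ha a' ha' _
    simp only [hQ, coe_filter, Set.mem_ofPred_eq] at ha ha'
    obtain ⟨_, ⟨_, h2⟩, h3⟩ := ha
    obtain ⟨_, ⟨_, h5⟩, h6⟩ := ha'
    funext i
    have h7 : a i ∈ univ.image a' := by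
      rw [h5, ← h2]
      exact mem_image_of_mem _ (mem_univ i)
    obtain ⟨j, _, hj⟩ := mem_image.1 h7
    have h8 : Λ.anti j = Λ.anti i := by rw [← h6.1 j, hj, h3.1 i]
    rw [← hj, Λ.anti_strictAnti.injective h8]
  · ext t
    simp only [Set.mem_inter_iff, Function.mem_support, mem_coe]
    refine and_congr_left fun ht => ?_
    rw [mem_image]
    constructor
    · rintro ⟨i, j, hinj, rfl⟩
      obtain ⟨h1, h2, h3⟩ := cTerm_coeff_ne_zero ht
      refine ⟨i, ?_, by rw [h3]⟩
      rw [hQ, mem_filter]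
      refine ⟨Fintype.mem_piFinset.2 fun t => h2 ▸ mem_image_of_mem _ (mem_univ t), ⟨h1, h2⟩, ?_⟩
      exact (exists_expo_eq_iff Λ h1 α).1 ⟨j, hinj, h3⟩
    · rintro ⟨a, ha, rfl⟩
      rw [hQ, mem_filter] at ha
      obtain ⟨j, h1, h2⟩ := (exists_expo_eq_iff Λ ha.2.1.1 α).2 ha.2.2
      exact ⟨a, j, h1, by rw [h2]⟩

/-- Given a, a word in M(K) amounts to a choice of letters for the nonfermionic blocks, different
from each other and from all a_i. -/
theorem inM_iff (K : SetSupercomp n m) {a : Fin m → ℕ} (ha : Function.Injective a)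
    (b : Fin n → ℕ) :
    InM K a b ↔ ∃ y : {B // B ∈ K.bos} → ℕ, Function.Injective (Sum.elim a y) ∧
      b = Sum.elim a y ∘ K.idx := by
  have hferm : ∀ i j, j ∈ K.ferm i ↔ K.idx j = Sum.inl i := fun i j =>
    K.mem_block (t := Sum.inl i)
  constructor
  · rintro ⟨h1, h2⟩
    have hidx : ∀ B : {B // B ∈ K.bos}, K.idx (K.bos_nonempty B.1 B.2).choose = Sum.inr B :=
      fun B => K.mem_block.1 (K.bos_nonempty B.1 B.2).choose_spec
    refine ⟨fun B => b (K.bos_nonempty B.1 B.2).choose, ?_, ?_⟩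
    · rintro (i | B) (j | C) h <;> simp only [Sum.elim_inl, Sum.elim_inr] at h
      · exact congrArg _ (ha h)
      · have := (hferm _ _).1 ((h1 _ _).1 h)
        rw [hidx] at this
        cases this
      · have := (hferm _ _).1 ((h1 _ _).1 h.symm)
        rw [hidx] at this
        cases this
      · have := K.sameBlock_iff.1 ((h2 _ _).1 h)
        rwa [hidx, hidx] at this
    · funext j
      rw [Function.comp]
      rcases hj : K.idx j with i | B
      · exact ((h1 i j).2 ((hferm i j).2 hj)).symm
      · refine (h2 _ _).2 (K.sameBlock_iff.2 ?_)
        rw [hj, hidx]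
  · rintro ⟨y, h1, rfl⟩
    refine ⟨fun i j => ?_, fun i j => ?_⟩
    · rw [hferm, eq_comm (a := K.idx j)]
      exact h1.eq_iff (a := Sum.inl i)
    · rw [K.sameBlock_iff]
      exact h1.eq_iff

theorem content_comp_idx (K : SetSupercomp n m) (a : Fin m → ℕ) (y : {B // B ∈ K.bos} → ℕ) :
    content (Sum.elim a y ∘ K.idx) =
      ∑ i, Finsupp.single (a i) (K.ferm i).card + ∑ B, Finsupp.single (y B) B.1.card := by
  rw [content, ← sum_fiberwise univ K.idx, Fintype.sum_sum_type]
  have h : ∀ t, ∑ j ∈ univ.filter (fun j => K.idx j = t),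
      Finsupp.single ((Sum.elim a y ∘ K.idx) j) 1 =
        Finsupp.single (Sum.elim a y t) (K.block t).card := by
    intro t
    have h1 : univ.filter (fun j => K.idx j = t) = K.block t := by
      ext j
      simp [K.mem_block]
    rw [h1, sum_congr rfl (g := fun _ => Finsupp.single (Sum.elim a y t) 1) fun j hj => by
      rw [Function.comp, K.mem_block.1 hj]]
    simp
  simp only [h]
  rfl

-- With a fixed, the letters of the nonfermionic blocks must exhaust the remaining variables of x^α
-- with exponents equal to the block sizes, so the words correspond to size-preserving bijections.
open Classical in
theorem card_inM (K : SetSupercomp n m) {a : Fin m → ℕ} (ha : Function.Injective a)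
    (α : ℕ →₀ ℕ) :
    ((Fintype.piFinset fun _ : Fin n => α.support).filter fun b =>
      content b = α ∧ InM K a b).card =
    if (∀ i, α (a i) = (K.ferm i).card) ∧
      otherExponents α (univ.image a) = K.bos.val.map Finset.card then
        multFactorial (K.bos.val.map Finset.card) else 0 := by
  have hpos : ∀ B : {B // B ∈ K.bos}, 0 < B.1.card := fun B => card_pos.2 (K.bos_nonempty _ B.2)
  have hbos : K.bos.val.map Finset.card = univ.val.map fun B : {B // B ∈ K.bos} => B.1.card := by
    conv_lhs => rw [← attach_map_val (s := K.bos), map_val, Multiset.map_map]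
    rfl
  by_cases h : ∀ i, α (a i) = (K.ferm i).card
  · have h1 := card_equiv_comp_eq (fun B : {B // B ∈ K.bos} => B.1.card)
      (fun v : {v // v ∈ α.support \ univ.image a} => α v)
    rw [← otherExponents_eq, ← hbos] at h1
    refine Eq.trans ?_ (h1.trans (if_congr ?_ rfl rfl))
    swap
    · rw [eq_comm, and_iff_right h]
    rw [← card_univ]
    symm
    refine card_bij (fun e _ => Sum.elim a (fun B => (e.1 B : ℕ)) ∘ K.idx) ?_ ?_ ?_
    · rintro ⟨e, he⟩ -
      have h2 := (injective_and_sum_single_iff ha (fun B => (e B : ℕ)) (fun i => (K.ferm i).card)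
        hpos α).2 ⟨h, e, he, fun _ => rfl⟩
      have h3 := (content_comp_idx K a fun B => (e B : ℕ)).trans h2.2
      exact mem_filter.2 ⟨mem_piFinset_of_content h3 subset_rfl, h3,
        (inM_iff K ha _).2 ⟨_, h2.1, rfl⟩⟩
    -- Each nonfermionic block is nonempty, so the word recovers the letter of every block.
    · rintro ⟨e, he⟩ - ⟨e', he'⟩ - hee
      refine Subtype.ext (Equiv.ext fun B => Subtype.ext ?_)
      obtain ⟨x, hx⟩ := K.bos_nonempty B.1 B.2
      have h2 := congrFun hee x
      have h3 : K.idx x = Sum.inr B := K.mem_block.1 hx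
      simpa [h3] using h2
    · intro b hb
      obtain ⟨_, h2, h3⟩ := mem_filter.1 hb
      obtain ⟨y, h4, rfl⟩ := (inM_iff K ha b).1 h3
      rw [content_comp_idx] at h2
      obtain ⟨_, e, h5, h6⟩ := (injective_and_sum_single_iff ha y _ hpos α).1 ⟨h4, h2⟩
      refine ⟨⟨e, h5⟩, mem_univ _, ?_⟩
      simp only [h6]
  · rw [if_neg fun h' => h h'.1, card_eq_zero, filter_eq_empty_iff]
    rintro b - ⟨h2, h3⟩
    obtain ⟨y, h4, rfl⟩ := (inM_iff K ha b).1 h3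
    rw [content_comp_idx] at h2
    exact h ((injective_and_sum_single_iff ha y _ hpos α).1 ⟨h4, h2⟩).1

open Classical in
theorem coeff_rho_ncMonomial (K : SetSupercomp n m) (S : Finset ℕ) (α : ℕ →₀ ℕ) :
    MvPowerSeries.coeff α ((rho (ncMonomial K)).1 S) =
      thetaSum (fun a => (multFactorial (K.bos.val.map Finset.card) : ℚ) *
        if (∀ i, α (a i) = (K.ferm i).card) ∧
          otherExponents α (univ.image a) = K.bos.val.map Finset.card then 1 else 0) S := by
  rw [ncMonomial, coeff_rho_ncSum]
  refine thetaSum_congr fun a ha _ => ?_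
  have h1 := congrArg (Nat.cast (R := ℚ)) (card_inM K ha α)
  simp only [mul_ite, mul_one, mul_zero]
  rw [Nat.cast_ite, Nat.cast_zero] at h1
  rw [← h1, card_filter, Nat.cast_sum]
  refine sum_congr rfl fun b _ => ?_
  by_cases h2 : content b = α <;> by_cases h3 : InM K a b <;> simp [h2, h3]

theorem image_comp_perm (a : Fin m → ℕ) (σ : Equiv.Perm (Fin m)) :
    univ.image (a ∘ σ) = univ.image a := by
  rw [← image_image, image_univ_equiv]

theorem rho_ncMonomial (I : SetSuperpartition n m) (h : Function.Injective I.fermSize) :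
    rho (ncMonomial I.toSetSupercomp) =
      ((-1 : ℚ) ^ I.eps h * ((I.type h).symMultFactorial : ℚ)) • cMonomial (I.type h) := by
  classical
  refine CFun.ext_coeff fun S α => ?_
  have hM : multFactorial (I.bos.val.map Finset.card) = (I.type h).symMultFactorial := by
    rw [← I.type_sym h, multFactorial, Superpartition.symMultFactorial]
    simp only [Multiset.coe_count]
    rfl
  rw [coeff_rho_ncMonomial, CFun.coeff_smul, coeff_cMonomial, I.neg_one_pow_eps h, mul_assoc,
    ← thetaSum_mul_left, ← thetaSum_comp_perm, hM]
  congr 1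
  funext a
  congr 1
  rw [image_comp_perm, I.type_sym h]
  refine if_congr (and_congr_left fun _ => ?_) rfl rfl
  exact (I.sortPerm.forall_congr_right (q := fun i => α (a i) = (I.ferm i).card)).symm

theorem rho_ncMonomial_eq_zero (I : SetSuperpartition n m)
    (h : ∃ i j : Fin m, i ≠ j ∧ I.fermSize i = I.fermSize j) :
    rho (ncMonomial I.toSetSupercomp) = 0 := by
  classical
  obtain ⟨i, j, hij, hs⟩ := h
  refine CFun.ext_coeff fun S α => ?_
  rw [coeff_rho_ncMonomial, CFun.coeff_zero]
  refine thetaSum_eq_zero hij fun a => ?_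
  congr 1
  rw [image_comp_perm]
  refine if_congr (and_congr_left fun _ => ?_) rfl rfl
  rw [← (Equiv.swap i j).forall_congr_right (q := fun i => α (a i) = (I.ferm i).card)]
  refine forall_congr' fun k => ?_
  rw [I.card_ferm_swap hs]
  rfl

/-! ### Coefficients of the commuting elementary and homogeneous functions -/

theorem thetaSum_of_card_ne {w : (Fin m → ℕ) → ℚ} {S : Finset ℕ} (h : S.card ≠ m) :
    thetaSum w S = 0 := by
  refine sum_eq_zero fun a _ => ?_
  rw [thetaCoeff, if_neg, zero_mul]
  rintro ⟨h1, h2⟩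
  apply h
  rw [← h2, card_image_of_injective _ h1, card_univ, Fintype.card_fin]

theorem thetaSum_fin_zero (w : (Fin 0 → ℕ) → ℚ) : thetaSum w ∅ = w Fin.elim0 := by
  rw [thetaSum, Fintype.piFinset_of_isEmpty, Fintype.sum_unique]
  have h : ∀ a : Fin 0 → ℕ, thetaCoeff a ∅ = 1 := fun a => by
    simp [thetaCoeff, inversions, Function.injective_of_subsingleton]
  rw [h, one_mul]
  exact congrArg w (Subsingleton.elim _ _)

theorem thetaSum_fin_one (w : (Fin 1 → ℕ) → ℚ) (x : ℕ) : thetaSum w {x} = w fun _ => x := by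
  rw [thetaSum, Fintype.piFinset_singleton, sum_singleton]
  simp [thetaCoeff, inversions, Function.injective_of_subsingleton]

theorem coeff_cMonomial_fin_zero (Λ : Superpartition n 0) (α : ℕ →₀ ℕ) :
    MvPowerSeries.coeff α ((cMonomial Λ).1 ∅) =
      if otherExponents α ∅ = Λ.sym then 1 else 0 := by
  rw [coeff_cMonomial, thetaSum_fin_zero]
  exact if_congr (by simp) rfl rfl

theorem coeff_cMonomial_fin_one (Λ : Superpartition n 1) (x : ℕ) (α : ℕ →₀ ℕ) :
    MvPowerSeries.coeff α ((cMonomial Λ).1 {x}) =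
      if α x = Λ.anti 0 ∧ otherExponents α {x} = Λ.sym then 1 else 0 := by
  rw [coeff_cMonomial, thetaSum_fin_one]
  exact if_congr (by simp) rfl rfl

theorem cMonomial_of_card_ne (Λ : Superpartition n m) {S : Finset ℕ} (h : S.card ≠ m) :
    (cMonomial Λ).1 S = 0 := by
  ext α
  rw [coeff_cMonomial, thetaSum_of_card_ne h]
  simp

theorem degree_eq_add (α : ℕ →₀ ℕ) {a : Fin m → ℕ} (ha : Function.Injective a) :
    α.degree = ∑ i, α (a i) + (otherExponents α (univ.image a)).sum := by
  have h1 : α.degree = ∑ v ∈ α.support ∪ univ.image a, α v := by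
    rw [Finsupp.degree_apply]
    exact sum_subset subset_union_left fun v _ hv => Finsupp.notMem_support_iff.1 hv
  rw [h1, union_comm, ← union_sdiff_self_eq_union, sum_union disjoint_sdiff,
    sum_image fun _ _ _ _ h => ha h]
  rfl

/-- There is exactly one superpartition that a monomial of the right degree can belong to. -/
theorem sum_superpartition {a : Fin m → ℕ} (ha : Function.Injective a) {α : ℕ →₀ ℕ}
    (hs : StrictAnti (α ∘ a)) (c : (Fin m → ℕ) → ℚ) :
    ∑ Λ : Superpartition n m, (c Λ.anti * if (∀ i, α (a i) = Λ.anti i) ∧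
      otherExponents α (univ.image a) = Λ.sym then 1 else 0) =
    if α.degree = n then c (α ∘ a) else 0 := by
  split_ifs with h
  -- The only candidate is read off from the monomial: the exponents at the θ-indices, and the other
  -- exponents sorted.
  · let Λ₀ : Superpartition n m :=
      { anti := α ∘ a
        sym := (otherExponents α (univ.image a)).sort (· ≥ ·)
        anti_strictAnti := hs
        sym_sorted := Multiset.pairwise_sort _ _
        sym_pos := fun r hr => by
          rw [Multiset.mem_sort, otherExponents, Multiset.mem_map] at hr
          obtain ⟨v, hv, rfl⟩ := hr
          exact Nat.pos_of_ne_zero (Finsupp.mem_support_iff.1 (mem_sdiff.1 hv).1)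
        sum_eq := by
          rw [← Multiset.sum_coe, Multiset.sort_eq, ← h, degree_eq_add α ha]
          rfl }
    have h0 : (Λ₀.sym : Multiset ℕ) = otherExponents α (univ.image a) := Multiset.sort_eq _ _
    rw [sum_eq_single Λ₀]
    · rw [if_pos ⟨fun i => rfl, h0.symm⟩, mul_one]
    · intro Λ _ hne
      rw [if_neg, mul_zero]
      rintro ⟨h1, h2⟩
      refine hne (Superpartition.ext (funext fun i => (h1 i).symm) ?_)
      refine List.Perm.eq_of_pairwise (fun _ _ _ _ h3 h4 => le_antisymm h4 h3) Λ.sym_sorted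
        Λ₀.sym_sorted (Multiset.coe_eq_coe.1 (h2.symm.trans h0.symm))
    · simp
  · refine sum_eq_zero fun Λ _ => ?_
    rw [if_neg, mul_zero]
    rintro ⟨h1, h2⟩
    apply h
    rw [degree_eq_add α ha, h2, Multiset.sum_coe, sum_congr rfl fun i _ => h1 i, Λ.sum_eq]

theorem coeff_cHom (r : ℕ) (α : ℕ →₀ ℕ) :
    MvPowerSeries.coeff α ((cHom r).1 ∅) = if α.degree = r then 1 else 0 := by
  have h := sum_superpartition (n := r) (a := (Fin.elim0 : Fin 0 → ℕ)) (α := α)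
    (fun i => i.elim0) (fun i => i.elim0) fun _ => 1
  rw [← h, cHom, AddSubmonoidClass.coe_finsetSum, Finset.sum_apply, map_sum]
  refine sum_congr rfl fun Λ _ => ?_
  rw [coeff_cMonomial_fin_zero, one_mul]
  exact if_congr (by simp) rfl rfl

/-- The monomial θ_x x^α of degree k in x occurs in exactly one m_Λ, where Λ_1 is the exponent of x;
the weight Λ_1 + 1 becomes α_x + 1. -/
theorem coeff_cHomTilde (k x : ℕ) (α : ℕ →₀ ℕ) :
    MvPowerSeries.coeff α ((cHomTilde k).1 {x}) =
      if α.degree = k then (α x : ℚ) + 1 else 0 := by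
  have h := sum_superpartition (n := k) (a := fun _ : Fin 1 => x) (α := α)
    (Function.injective_of_subsingleton _) (fun i j hij => absurd hij (by simp [Subsingleton.elim i j]))
    fun u => (u 0 : ℚ) + 1
  rw [Function.comp] at h
  rw [← h, cHomTilde, AddSubmonoidClass.coe_finsetSum, Finset.sum_apply, map_sum]
  refine sum_congr rfl fun Λ _ => ?_
  rw [CFun.coeff_smul, coeff_cMonomial_fin_one]
  congr 1
  exact if_congr (by simp) rfl rfl

theorem expFactorial_single (x k : ℕ) : expFactorial (Finsupp.single x k) = k.factorial := by
  rcases Nat.eq_zero_or_pos k with rfl | hk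
  · simp [expFactorial]
  · rw [expFactorial, Finsupp.support_single x hk.ne', prod_singleton, Finsupp.single_eq_same]

theorem expFactorial_eq_one {α : ℕ →₀ ℕ} (h : ∀ v, α v ≤ 1) : expFactorial α = 1 :=
  prod_eq_one fun v _ => Nat.factorial_eq_one.2 (h v)

theorem otherExponents_eq_replicate_iff {α : ℕ →₀ ℕ} {T : Finset ℕ} (hT : ∀ v ∈ T, α v = 0)
    (k : ℕ) : otherExponents α T = Multiset.replicate k 1 ↔ α.degree = k ∧ ∀ v, α v ≤ 1 := by
  have h0 : α.support \ T = α.support := sdiff_eq_self_of_disjoint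
    (disjoint_left.2 fun v hv hvT => Finsupp.mem_support_iff.1 hv (hT v hvT))
  rw [otherExponents, h0, Multiset.eq_replicate, Multiset.card_map]
  have h1 : (∀ r ∈ α.support.val.map α, r = 1) ↔ ∀ v, α v ≤ 1 := by
    simp only [Multiset.mem_map, mem_val, Finsupp.mem_support_iff, forall_exists_index, and_imp,
      forall_apply_eq_imp_iff₂]
    refine forall_congr' fun v => ?_
    omega
  rw [h1]
  refine and_congr_left fun h2 => ?_
  rw [Finsupp.degree_apply, sum_congr rfl (g := fun _ => 1) fun v hv => by
    have := Finsupp.mem_support_iff.1 hv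
    have := h2 v
    omega]
  simp

open Classical in
theorem coeff_cElem (r : ℕ) (α : ℕ →₀ ℕ) :
    MvPowerSeries.coeff α ((cElem r).1 ∅) =
      if α.degree = r ∧ ∀ v, α v ≤ 1 then 1 else 0 := by
  rw [cElem, coeff_cMonomial_fin_zero]
  exact if_congr (otherExponents_eq_replicate_iff (by simp) r) rfl rfl

open Classical in
theorem coeff_cElemTilde (k x : ℕ) (α : ℕ →₀ ℕ) :
    MvPowerSeries.coeff α ((cElemTilde k).1 {x}) =
      if α x = 0 ∧ α.degree = k ∧ ∀ v, α v ≤ 1 then 1 else 0 := by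
  rw [cElemTilde, coeff_cMonomial_fin_one]
  exact if_congr (and_congr_right fun h =>
    otherExponents_eq_replicate_iff (by simpa [zeroOnes] using h) k) rfl rfl

/-! ### The block data of p, e and h -/

open Classical in
/-- The power sums. -/
def powerData : BlockData where
  F := cPowerSumTilde
  G := cPowerSum
  s _ := 1
  f x β := if β = Finsupp.single x β.degree then 1 else 0
  g β := if ∃ v, β = Finsupp.single v β.degree then 1 else 0
  F_odd k S hS := by
    refine sum_eq_zero fun i _ => if_neg ?_
    rintro rfl
    exact hS (card_singleton i)
  G_even r S hS := by
    ext α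
    exact if_neg hS
  F_coeff k x β := by
    rw [one_mul]
    simp only [cPowerSumTilde, sum_singleton, if_true]
    rw [MvPowerSeries.coeff_X_pow]
    -- The only exponent that matters is that of x^k, which comes from the single constant word:
    -- k!/β! = 1.
    by_cases h : β = Finsupp.single x k
    · subst h
      rw [if_pos rfl, Finsupp.degree_single, if_pos rfl, if_pos rfl, expFactorial_single, one_mul,
        div_self (Nat.cast_ne_zero.2 (Nat.factorial_ne_zero k))]
    · rw [if_neg h]
      split_ifs with h1 h2
      · rw [h1] at h2
        exact absurd h2 h
      · rw [zero_mul]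
      · rfl
  G_coeff r hr β := by
    rw [one_mul]
    change (if (∅ : Finset ℕ) = ∅ then
      ∑ i ∈ β.support, (if β = Finsupp.single i r then (1 : ℚ) else 0) else 0) = _
    rw [if_pos rfl]
    by_cases h : ∃ v, β = Finsupp.single v r
    · obtain ⟨v, rfl⟩ := h
      rw [Finsupp.support_single v hr.ne', sum_singleton, if_pos rfl, Finsupp.degree_single,
        if_pos rfl, if_pos ⟨v, rfl⟩, expFactorial_single, one_mul,
        div_self (Nat.cast_ne_zero.2 (Nat.factorial_ne_zero r))]
    · rw [sum_eq_zero fun i _ => if_neg fun h1 => h ⟨i, h1⟩]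
      split_ifs with h1 h2
      · rw [h1] at h2
        exact absurd h2 h
      · rw [zero_mul]
      · rfl

open Classical in
/-- The elementary functions. -/
def elementaryData : BlockData where
  F := cElemTilde
  G := cElem
  -- A squarefree monomial of degree k is the content of k! words, which is where the factor Λ!
  -- comes from.
  s k := k.factorial
  f x β := if (∀ v, β v ≤ 1) ∧ β x = 0 then 1 else 0
  g β := if ∀ v, β v ≤ 1 then 1 else 0
  F_odd k S hS := cMonomial_of_card_ne _ hS
  G_even r S hS := cMonomial_of_card_ne _ (mt card_eq_zero.1 hS)
  F_coeff k x β := by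
    rw [coeff_cElemTilde]
    by_cases h : β.degree = k <;> by_cases h1 : ∀ v, β v ≤ 1 <;> by_cases h2 : β x = 0 <;>
      simp [h, h1, h2, expFactorial_eq_one]
  G_coeff r _ β := by
    rw [coeff_cElem]
    by_cases h : β.degree = r <;> by_cases h1 : ∀ v, β v ≤ 1 <;>
      simp [h, h1, expFactorial_eq_one]

/-- The complete homogeneous functions. -/
def homogeneousData : BlockData where
  F := cHomTilde
  G := cHom
  -- The weight β! cancels the denominator in the number k!/β! of words and leaves k!.
  s k := k.factorial
  f x β := ((β x : ℚ) + 1) * expFactorial β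
  g β := expFactorial β
  F_odd k S hS := by
    rw [cHomTilde, AddSubmonoidClass.coe_finsetSum, Finset.sum_apply]
    refine sum_eq_zero fun Λ _ => ?_
    exact (congrArg (((Λ.anti 0 : ℚ) + 1) • ·) (cMonomial_of_card_ne Λ hS)).trans (smul_zero _)
  G_even r S hS := by
    rw [cHom, AddSubmonoidClass.coe_finsetSum, Finset.sum_apply]
    exact sum_eq_zero fun Λ _ => cMonomial_of_card_ne Λ (mt card_eq_zero.1 hS)
  F_coeff k x β := by
    have := expFactorial_ne_zero β
    rw [coeff_cHomTilde]
    split_ifs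
    · field_simp
    · rw [mul_zero]
  G_coeff r _ β := by
    have := expFactorial_ne_zero β
    rw [coeff_cHom]
    split_ifs
    · field_simp
    · rw [mul_zero]

/-! ### Membership in P(K) and E(K), tested block by block -/

section contentConditions

variable {J : Type*} [Fintype J] (b : J → ℕ)

theorem content_eq_single_iff (v : ℕ) :
    content b = Finsupp.single v (content b).degree ↔ ∀ j, b j = v := by
  constructor
  · intro h j
    have h1 := mem_support_content b j
    rw [h] at h1
    simpa using Finsupp.support_single_subset h1
  · intro h
    rw [degree_content, content]
    simp [h]

theorem content_apply_eq_zero_iff (v : ℕ) : content b v = 0 ↔ ∀ j, v ≠ b j := by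
  rw [← Finsupp.notMem_support_iff, support_content]
  simp [eq_comm]

theorem content_le_one_iff : (∀ v, content b v ≤ 1) ↔ Function.Injective b := by
  constructor
  · intro h i j hij
    have h1 := h (b j)
    rw [content_apply, card_le_one] at h1
    exact h1 i (by simp [hij]) j (by simp)
  · intro h v
    rw [content_apply, card_le_one]
    intro i hi j hj
    simp only [mem_filter, mem_univ, true_and] at hi hj
    exact h (hi.trans hj.symm)

end contentConditions

namespace SetSupercomp

variable (K : SetSupercomp n m)

theorem mem_ferm {i : Fin m} {j : Fin n} : j ∈ K.ferm i ↔ K.idx j = Sum.inl i :=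
  K.mem_block (t := Sum.inl i)

theorem mem_bos {B : {B // B ∈ K.bos}} {j : Fin n} : j ∈ B.1 ↔ K.idx j = Sum.inr B :=
  K.mem_block (t := Sum.inr B)

/-- The conditions concern one block at a time: the word is constant on each block, with the
prescribed value a_i on K_i. A content detects this by being concentrated at one variable. -/
theorem inP_iff (a : Fin m → ℕ) (b : Fin n → ℕ) :
    InP K a b ↔ (∀ i, K.blockContent b (Sum.inl i) =
        Finsupp.single (a i) (K.blockContent b (Sum.inl i)).degree) ∧
      ∀ B, ∃ v, K.blockContent b (Sum.inr B) =
        Finsupp.single v (K.blockContent b (Sum.inr B)).degree := by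
  simp only [blockContent, content_eq_single_iff, Subtype.forall, mem_block]
  constructor
  · rintro ⟨h1, h2⟩
    refine ⟨fun i j hj => (h1 i j (K.mem_ferm.2 hj)).symm, fun B hB => ?_⟩
    obtain ⟨x, hx⟩ := K.bos_nonempty B hB
    refine ⟨b x, fun j hj => h2 j x (K.sameBlock_iff.2 ?_)⟩
    rw [hj]
    exact (K.mem_bos.1 hx).symm
  · rintro ⟨h1, h2⟩
    refine ⟨fun i j hj => (h1 i j (K.mem_ferm.1 hj)).symm, fun i j hij => ?_⟩
    rw [K.sameBlock_iff] at hij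
    rcases h : K.idx j with t | B
    · rw [h1 t j h, h1 t i (hij.trans h)]
    · obtain ⟨v, hv⟩ := h2 B.1 B.2
      rw [hv j h, hv i (hij.trans h)]

/-- On each block the word is injective, meaning that its content is squarefree, and on K_i it
avoids a_i, meaning that the exponent of a_i is 0. -/
theorem inE_iff (a : Fin m → ℕ) (b : Fin n → ℕ) :
    InE K a b ↔ (∀ i, (∀ v, K.blockContent b (Sum.inl i) v ≤ 1) ∧
        K.blockContent b (Sum.inl i) (a i) = 0) ∧
      ∀ B, ∀ v, K.blockContent b (Sum.inr B) v ≤ 1 := by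
  simp only [blockContent, content_le_one_iff, content_apply_eq_zero_iff]
  have hinj : (∀ i j, i ≠ j → K.SameBlock i j → b i ≠ b j) ↔
      ∀ t, Function.Injective fun j : K.block t => b j := by
    constructor
    · rintro h t ⟨i, hi⟩ ⟨j, hj⟩ hij
      by_contra hne
      exact h i j (fun h' => hne (Subtype.ext h')) (K.sameBlock_iff.2
        ((K.mem_block.1 hi).trans (K.mem_block.1 hj).symm)) hij
    · intro h i j hne hij hb
      rw [K.sameBlock_iff] at hij
      exact hne (congrArg Subtype.val
        (@h (K.idx j) ⟨i, K.mem_block.2 hij⟩ ⟨j, K.mem_block.2 rfl⟩ hb))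
  rw [InE, hinj, Sum.forall, forall_and]
  simp only [Subtype.forall, block, Sum.elim_inl]
  tauto

end SetSupercomp

open Classical in
theorem powerData_weight (K : SetSupercomp n m) (a : Fin m → ℕ) (b : Fin n → ℕ) :
    powerData.weight K a b = if InP K a b then 1 else 0 := by
  rw [BlockData.weight]
  simp only [powerData]
  rw [prod_ite_zero, prod_ite_zero]
  simp only [prod_const_one, mem_univ, forall_const, ← ite_and, mul_ite, mul_one, mul_zero]
  exact if_congr ((K.inP_iff a b).trans and_comm).symm rfl rfl

open Classical in
theorem elementaryData_weight (K : SetSupercomp n m) (a : Fin m → ℕ) (b : Fin n → ℕ) :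
    elementaryData.weight K a b = if InE K a b then 1 else 0 := by
  rw [BlockData.weight]
  simp only [elementaryData]
  rw [prod_ite_zero, prod_ite_zero]
  simp only [prod_const_one, mem_univ, forall_const, ← ite_and, mul_ite, mul_one, mul_zero]
  exact if_congr ((K.inE_iff a b).trans and_comm).symm rfl rfl

theorem coeff_rho_ncPower (K : SetSupercomp n m) (S : Finset ℕ) (α : ℕ →₀ ℕ) :
    MvPowerSeries.coeff α ((rho (ncPower K)).1 S) = thetaSum (fun a =>
      ∑ b ∈ Fintype.piFinset fun _ : Fin n => α.support,
        if content b = α then powerData.weight K a b else 0) S := by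
  simp only [ncPower, coeff_rho_ncSum, powerData_weight]

theorem coeff_rho_ncElementary (K : SetSupercomp n m) (S : Finset ℕ) (α : ℕ →₀ ℕ) :
    MvPowerSeries.coeff α ((rho (ncElementary K)).1 S) = thetaSum (fun a =>
      ∑ b ∈ Fintype.piFinset fun _ : Fin n => α.support,
        if content b = α then elementaryData.weight K a b else 0) S := by
  simp only [ncElementary, coeff_rho_ncSum, elementaryData_weight]

/-! ### The supercomposition L of a monomial, and the product formula for (K ⊓ L)! -/

namespace InM

variable {L : SetSupercomp n m} {a : Fin m → ℕ} {b : Fin n → ℕ}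

theorem ferm_eq (h : InM L a b) (i : Fin m) : L.ferm i = univ.filter fun j => a i = b j := by
  ext j
  simp [h.1 i j]

theorem under_eq (h : InM L a b) {C : Finset (Fin n)} (hC : C ∈ L.under) {j : Fin n}
    (hj : j ∈ C) : C = univ.filter fun k => b k = b j := by
  have h1 : ∃ u, L.block u = C := by
    rcases SetSupercomp.mem_under.1 hC with ⟨_, i, hi⟩ | hB
    · exact ⟨Sum.inl i, hi⟩
    · exact ⟨Sum.inr ⟨C, hB⟩, rfl⟩
  obtain ⟨u, rfl⟩ := h1
  ext k
  rw [mem_filter, h.2, L.sameBlock_iff, L.mem_block, L.mem_block.1 hj]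
  simp

theorem mem_bos_iff (h : InM L a b) (C : Finset (Fin n)) :
    C ∈ L.bos ↔ ∃ j, (∀ i, a i ≠ b j) ∧ C = univ.filter fun k => b k = b j := by
  constructor
  · intro hC
    obtain ⟨j, hj⟩ := L.bos_nonempty C hC
    refine ⟨j, fun i hi => ?_, h.under_eq (SetSupercomp.mem_under.2 (Or.inr hC)) hj⟩
    exact disjoint_left.1 (L.ferm_bos_disjoint i C hC) ((h.1 i j).1 hi) hj
  · rintro ⟨j, h1, rfl⟩
    rcases L.cover j with ⟨i, hi⟩ | ⟨C, hC, hj⟩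
    · exact absurd ((h.1 i j).2 hi) (h1 i)
    · rwa [← h.under_eq (SetSupercomp.mem_under.2 (Or.inr hC)) hj]

/-- The equalities among the letters determine L: its fermionic blocks are where b takes the values
a_i, and the others are the remaining level sets of b. -/
theorem unique {L' : SetSupercomp n m} (h : InM L a b) (h' : InM L' a b) : L = L' := by
  apply SetSupercomp.ext
  · funext i
    rw [h.ferm_eq, h'.ferm_eq]
  · ext C
    rw [h.mem_bos_iff, h'.mem_bos_iff]

end InM

/-- Every monomial belongs to some `M(L)`. -/
theorem exists_inM (hm : m ≤ n + 1) {a : Fin m → ℕ} (ha : Function.Injective a) (b : Fin n → ℕ) :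
    ∃ L : SetSupercomp n m, InM L a b := by
  classical
  let bos : Finset (Finset (Fin n)) :=
    (univ.filter fun j => ∀ i, a i ≠ b j).image fun j => univ.filter fun k => b k = b j
  have hbos : ∀ C, C ∈ bos ↔ ∃ j, (∀ i, a i ≠ b j) ∧ C = univ.filter fun k => b k = b j := by
    intro C
    simp only [bos, mem_image, mem_filter, mem_univ, true_and, eq_comm]
  refine ⟨⟨fun i => univ.filter fun j => a i = b j, bos, ?_, ?_, ?_, ?_, ?_, hm⟩, ?_, ?_⟩
  · intro C hC
    obtain ⟨j, _, rfl⟩ := (hbos C).1 hC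
    exact ⟨j, by simp⟩
  · intro i j hij
    refine disjoint_left.2 fun k hk hk' => hij (ha ?_)
    rw [(mem_filter.1 hk).2, (mem_filter.1 hk').2]
  · intro B hB C hC hne
    obtain ⟨j, _, rfl⟩ := (hbos B).1 hB
    obtain ⟨k, _, rfl⟩ := (hbos C).1 hC
    refine disjoint_left.2 fun l hl hl' => hne ?_
    rw [← (mem_filter.1 hl).2, ← (mem_filter.1 hl').2]
  · intro i B hB
    obtain ⟨j, hj, rfl⟩ := (hbos B).1 hB
    refine disjoint_left.2 fun l hl hl' => hj i ?_
    rw [(mem_filter.1 hl).2, (mem_filter.1 hl').2]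
  · intro j
    by_cases h : ∃ i, a i = b j
    · obtain ⟨i, hi⟩ := h
      exact Or.inl ⟨i, by simp [hi]⟩
    · exact Or.inr ⟨_, (hbos _).2 ⟨j, fun i hi => h ⟨i, hi⟩, rfl⟩, by simp⟩
  · intro i j
    simp
  · intro j k
    constructor
    · intro hjk
      by_cases h : ∃ i, a i = b j
      · obtain ⟨i, hi⟩ := h
        exact Or.inl ⟨i, by simp [hi], by simp [hi, hjk]⟩
      · exact Or.inr ⟨_, (hbos _).2 ⟨j, fun i hi => h ⟨i, hi⟩, rfl⟩, by simp, by simp [hjk]⟩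
    · rintro (⟨i, h1, h2⟩ | ⟨B, hB, h1, h2⟩)
      · rw [← (mem_filter.1 h1).2, ← (mem_filter.1 h2).2]
      · obtain ⟨l, _, rfl⟩ := (hbos B).1 hB
        rw [(mem_filter.1 h1).2, (mem_filter.1 h2).2]

/-- The part of a block with a given value of `b`, without the elements of
`SetSupercomp.commonFerm`. -/
def cell (K L : SetSupercomp n m) (b : Fin n → ℕ) (p : (Fin m ⊕ {B // B ∈ K.bos}) × ℕ) :
    Finset (Fin n) :=
  ((K.block p.1).filter fun j => b j = p.2) \ SetSupercomp.commonFerm K L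

variable {K L : SetSupercomp n m} {a : Fin m → ℕ} {b : Fin n → ℕ}

theorem mem_cell {p : (Fin m ⊕ {B // B ∈ K.bos}) × ℕ} {j : Fin n} :
    j ∈ cell K L b p ↔ (K.idx j = p.1 ∧ b j = p.2) ∧ j ∉ SetSupercomp.commonFerm K L := by
  rw [cell, mem_sdiff, mem_filter, K.mem_block]

/-- The blocks of L⁺ are level sets of b, so the nonfermionic blocks of the meet are the nonempty
level sets of b within the blocks of K, with the common fermionic elements removed. -/
theorem meet_bos (h : InM L a b) :
    (K.meet L).bos = ((univ ×ˢ univ.image b).image (cell K L b)).erase ∅ := by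
  ext C
  simp only [SetSupercomp.meet, mem_erase, mem_image]
  refine and_congr_right fun hC => ?_
  obtain ⟨x, hx⟩ := nonempty_iff_ne_empty.2 hC
  constructor
  · rintro ⟨p, hp, rfl⟩
    rw [mem_product] at hp
    simp only [mem_inter, mem_sdiff] at hx
    have h1 : p.1 = K.block (K.idx x) := by
      rcases SetSupercomp.mem_under.1 hp.1 with ⟨_, i, hi⟩ | hB
      · rw [← hi] at hx ⊢
        rw [K.mem_ferm.1 hx.1.1]
        rfl
      · rw [(K.mem_bos (B := ⟨p.1, hB⟩)).1 hx.1.1]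
        rfl
    have h2 := h.under_eq hp.2 hx.2.1
    refine ⟨(K.idx x, b x), by simp, ?_⟩
    ext j
    rw [cell, h1, h2]
    simp only [mem_inter, mem_sdiff, mem_filter, mem_univ, true_and]
    tauto
  · rintro ⟨p, -, rfl⟩
    have hx' := mem_cell.1 hx
    obtain ⟨D, hD, hxD⟩ := L.under_cover x
    have h1 : K.block p.1 ∈ K.under := by
      rcases h' : p.1 with i | B
      · refine SetSupercomp.mem_under.2 (Or.inl ⟨?_, i, rfl⟩)
        exact ne_empty_of_mem (K.mem_ferm.2 (hx'.1.1.trans h'))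
      · exact SetSupercomp.mem_under.2 (Or.inr B.2)
    refine ⟨(K.block p.1, D), mem_product.2 ⟨h1, hD⟩, ?_⟩
    ext j
    rw [cell, h.under_eq hD hxD]
    simp only [mem_inter, mem_sdiff, mem_filter, mem_univ, true_and, hx'.1.2]
    tauto

/-- Empty cells contribute 0! = 1, and nonempty cells with different labels are disjoint, so the
product can run over all labels. -/
theorem prod_meet_bos (h : InM L a b) :
    ∏ C ∈ (K.meet L).bos, C.card.factorial =
      ∏ t, ∏ v ∈ univ.image b, (cell K L b (t, v)).card.factorial := by
  have h1 : ((univ ×ˢ univ.image b).image (cell K L b)).erase ∅ =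
      ((univ ×ˢ univ.image b).filter fun p => cell K L b p ≠ ∅).image (cell K L b) := by
    ext C
    simp only [mem_erase, mem_image, mem_filter]
    constructor
    · rintro ⟨h1, p, hp, rfl⟩
      exact ⟨p, ⟨hp, h1⟩, rfl⟩
    · rintro ⟨p, ⟨hp, h1⟩, rfl⟩
      exact ⟨h1, p, hp, rfl⟩
  rw [meet_bos h, h1, prod_image, prod_filter_of_ne, prod_product]
  · intro p _ hp h2
    rw [h2] at hp
    exact hp rfl
  · intro p hp q _ hpq
    obtain ⟨x, hx⟩ := nonempty_iff_ne_empty.2 (mem_filter.1 hp).2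
    have hx' := hx
    rw [hpq] at hx'
    rw [mem_cell] at hx hx'
    exact Prod.ext (hx.1.1.symm.trans hx'.1.1) (hx.1.2.symm.trans hx'.1.2)

theorem mem_commonFerm_iff (h : InM L a b) {i : Fin m} {j : Fin n}
    (hj : j ∈ K.ferm i) : j ∈ SetSupercomp.commonFerm K L ↔ b j = a i := by
  rw [SetSupercomp.mem_commonFerm]
  constructor
  · rintro ⟨i', h1, h2⟩
    have h3 := (K.mem_ferm.1 h1).symm.trans (K.mem_ferm.1 hj)
    rw [← Sum.inl_injective h3]
    exact ((h.1 i' j).2 h2).symm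
  · intro h1
    exact ⟨i, hj, (h.1 i j).1 h1.symm⟩

/-- Inside K_i, the removed elements are exactly those with letter a_i. Thus the cell at a_i becomes
empty, and its factorial is supplied separately; all other cells are whole level sets. -/
theorem card_cell_inl (h : InM L a b) (i : Fin m) (v : ℕ) :
    (K.blockContent b (Sum.inl i) v).factorial =
      (if v = a i then (K.blockContent b (Sum.inl i) (a i)).factorial else 1) *
        (cell K L b (Sum.inl i, v)).card.factorial := by
  split_ifs with hv
  · have h1 : cell K L b (Sum.inl i, v) = ∅ := by
      rw [eq_empty_iff_forall_notMem]
      intro j hj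
      obtain ⟨⟨h2, h3⟩, h4⟩ := mem_cell.1 hj
      exact h4 ((mem_commonFerm_iff h (K.mem_ferm.2 h2)).2 (h3.trans hv))
    rw [h1, hv, card_empty, Nat.factorial_zero, mul_one]
  · rw [one_mul, K.blockContent_apply]
    congr 2
    ext j
    rw [mem_cell, mem_filter, K.mem_block]
    constructor
    · intro h2
      refine ⟨h2, fun h3 => hv ?_⟩
      rw [← h2.2]
      exact (mem_commonFerm_iff h (K.mem_ferm.2 h2.1)).1 h3
    · exact fun h2 => h2.1

theorem card_cell_inr (B : {B // B ∈ K.bos}) (v : ℕ) :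
    K.blockContent b (Sum.inr B) v = (cell K L b (Sum.inr B, v)).card := by
  rw [K.blockContent_apply]
  congr 1
  ext j
  rw [mem_cell, mem_filter, K.mem_block]
  constructor
  · intro h2
    refine ⟨h2, fun h3 => ?_⟩
    obtain ⟨i, h4, _⟩ := SetSupercomp.mem_commonFerm.1 h3
    have h5 := (K.mem_ferm.1 h4).symm.trans h2.1
    cases h5
  · exact fun h2 => h2.1

theorem support_blockContent_subset (t : Fin m ⊕ {B // B ∈ K.bos}) :
    (K.blockContent b t).support ⊆ univ.image b := by
  rw [SetSupercomp.blockContent, support_content]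
  intro v hv
  obtain ⟨j, _, rfl⟩ := mem_image.1 hv
  exact mem_image_of_mem _ (mem_univ _)

theorem expFactorial_blockContent (t : Fin m ⊕ {B // B ∈ K.bos}) :
    expFactorial (K.blockContent b t) = ∏ v ∈ univ.image b, (K.blockContent b t v).factorial :=
  prod_subset (support_blockContent_subset t) fun v _ hv => by
    rw [Finsupp.notMem_support_iff.1 hv, Nat.factorial_zero]

/-- The number `(K ⊓ L)!` is a product over the blocks of `K`. -/
theorem blockFactorial_meet (h : InM L a b) :
    ((K.meet L).blockFactorial : ℚ) = homogeneousData.weight K a b := by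
  have h1 : ∀ i, ((K.meet L).ferm i).card = K.blockContent b (Sum.inl i) (a i) := by
    intro i
    rw [K.blockContent_apply]
    congr 1
    ext j
    rw [mem_filter]
    change j ∈ K.ferm i ∩ L.ferm i ↔ _
    rw [mem_inter, ← h.1 i j, eq_comm]
    rfl
  have h2 : ∀ i, expFactorial (K.blockContent b (Sum.inl i)) =
      (K.blockContent b (Sum.inl i) (a i)).factorial *
        ∏ v ∈ univ.image b, (cell K L b (Sum.inl i, v)).card.factorial := by
    intro i
    rw [expFactorial_blockContent, prod_congr rfl fun v _ => card_cell_inl h i v,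
      prod_mul_distrib, prod_ite_eq']
    split_ifs with h3
    · rfl
    -- If a_i is not a letter of b, its exponent is 0 and the separate factor is 0! = 1.
    · rw [Finsupp.notMem_support_iff.1 fun h4 => h3 (support_blockContent_subset _ h4),
        Nat.factorial_zero]
  have h3 : ∀ B, expFactorial (K.blockContent b (Sum.inr B)) =
      ∏ v ∈ univ.image b, (cell K L b (Sum.inr B, v)).card.factorial := by
    intro B
    rw [expFactorial_blockContent]
    exact prod_congr rfl fun v _ => by rw [card_cell_inr]
  rw [SetSupercomp.blockFactorial, prod_meet_bos h, Fintype.prod_sum_type, BlockData.weight]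
  -- The element 0 of K_i ∩ L_i raises β(a_i)! to (β(a_i)+1)!, which produces the factor β(a_i)+1 of
  -- the weight.
  simp only [homogeneousData, h1, h2, h3, Nat.factorial_succ]
  push_cast
  simp only [prod_mul_distrib]
  ring

open Classical in
theorem sum_inM_blockFactorial (K : SetSupercomp n m) (ha : Function.Injective a)
    (b : Fin n → ℕ) :
    ∑ L : SetSupercomp n m, (if InM L a b then ((K.meet L).blockFactorial : ℚ) else 0) =
      homogeneousData.weight K a b := by
  obtain ⟨L, hL⟩ := exists_inM K.df_le ha b
  rw [sum_eq_single L, if_pos hL, blockFactorial_meet hL]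
  · intro L' _ hne
    exact if_neg fun h => hne (h.unique hL)
  · simp

/-- The weight sees a_i only through its exponent in the content of a block, and this is 0 for every
letter that does not occur in b. -/
theorem homogeneousData_weight_swap (K : SetSupercomp n m) (a : Fin m → ℕ) (b : Fin n → ℕ)
    {u v : ℕ} (hu : u ∉ univ.image b) (hv : v ∉ univ.image b) :
    homogeneousData.weight K (Equiv.swap u v ∘ a) b = homogeneousData.weight K a b := by
  have h0 : ∀ t w, w ∉ univ.image b → K.blockContent b t w = 0 := fun t w hw =>
    Finsupp.notMem_support_iff.1 fun h => hw (support_blockContent_subset t h)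
  rw [BlockData.weight, BlockData.weight]
  congr 1
  refine prod_congr rfl fun i _ => ?_
  simp only [homogeneousData]
  congr 3
  rw [Function.comp, Equiv.swap_apply_def]
  split_ifs with h1 h2
  · rw [h1, h0 _ _ hu, h0 _ _ hv]
  · rw [h2, h0 _ _ hu, h0 _ _ hv]
  · rfl

/-- Whether a monomial is null-symmetric depends only on S and α. If it is, two elements of S do not
occur in α, and exchanging them shows that the unrestricted sum vanishes as well; otherwise the
restriction is void. -/
theorem coeff_rho_ncHomogeneous (K : SetSupercomp n m) (S : Finset ℕ) (α : ℕ →₀ ℕ) :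
    MvPowerSeries.coeff α ((rho (ncHomogeneous K)).1 S) = thetaSum (fun a =>
      ∑ b ∈ Fintype.piFinset fun _ : Fin n => α.support,
        if content b = α then homogeneousData.weight K a b else 0) S := by
  classical
  rw [ncHomogeneous, coeff_rho_ncSum]
  have hnull : ∀ (a : Fin m → ℕ) (b : Fin n → ℕ), univ.image a = S → content b = α →
      (NullSymmetric a b ↔ 1 < (S \ α.support).card) := by
    intro a b h1 h2
    rw [NullSymmetric, h1, ← support_content, h2]
  by_cases hS : 1 < (S \ α.support).card
  · obtain ⟨u, hu, v, hv, huv⟩ := one_lt_card.1 hS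
    rw [mem_sdiff] at hu hv
    have h1 : thetaSum (fun a => ∑ b ∈ Fintype.piFinset fun _ : Fin n => α.support,
        if content b = α then homogeneousData.weight K a b else 0) S = 0 := by
      refine thetaSum_eq_zero_of_swap_values hu.1 hv.1 huv fun a _ _ => ?_
      refine sum_congr rfl fun b _ => ?_
      split_ifs with h2
      · rw [← h2, support_content] at hu hv
        exact homogeneousData_weight_swap K a b hu.2 hv.2
      · rfl
    rw [h1, thetaSum_congr (w' := fun _ => 0)]
    · simp [thetaSum]
    · intro a _ ha
      refine sum_eq_zero fun b _ => ?_
      split_ifs with h2 h3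
      · rfl
      · exact absurd ((hnull a b ha h2).2 hS) h3
      · rfl
  · refine thetaSum_congr fun a hinj ha => sum_congr rfl fun b _ => ?_
    split_ifs with h2 h3
    · exact absurd ((hnull a b ha h2).1 h3) hS
    · exact sum_inM_blockFactorial K hinj b
    · rfl

theorem prod_factorial_eq (Λ : Superpartition n m) :
    ((∏ i, ((Λ.anti i).factorial : ℚ)) * (Λ.sym.map fun k => (k.factorial : ℚ)).prod) =
      (Λ.factorial : ℚ) := by
  rw [Superpartition.factorial, Nat.cast_mul, Nat.cast_prod, Nat.cast_list_prod, List.map_map]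
  rfl

end Superspace

end

/-! ### The proposition -/

theorem mainTheorem7 {n m : ℕ} (I : Superspace.SetSuperpartition n m) :
    (∀ h : Function.Injective I.fermSize,
      Superspace.rho (Superspace.ncMonomial I.toSetSupercomp) =
          ((-1 : ℚ) ^ I.eps h * ((I.type h).symMultFactorial : ℚ)) •
            Superspace.cMonomial (I.type h) ∧
      Superspace.rho (Superspace.ncPower I.toSetSupercomp) =
          (-1 : ℚ) ^ I.eps h • Superspace.cPower (I.type h) ∧
      Superspace.rho (Superspace.ncElementary I.toSetSupercomp) =
          ((-1 : ℚ) ^ I.eps h * ((I.type h).factorial : ℚ)) •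
            Superspace.cElementary (I.type h) ∧
      Superspace.rho (Superspace.ncHomogeneous I.toSetSupercomp) =
          ((-1 : ℚ) ^ I.eps h * ((I.type h).factorial : ℚ)) •
            Superspace.cHomogeneous (I.type h)) ∧
    ((∃ i j : Fin m, i ≠ j ∧ I.fermSize i = I.fermSize j) →
      Superspace.rho (Superspace.ncMonomial I.toSetSupercomp) = 0 ∧
      Superspace.rho (Superspace.ncPower I.toSetSupercomp) = 0 ∧
      Superspace.rho (Superspace.ncElementary I.toSetSupercomp) = 0 ∧
      Superspace.rho (Superspace.ncHomogeneous I.toSetSupercomp) = 0) := by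
  refine ⟨fun h => ⟨Superspace.rho_ncMonomial I h, ?_, ?_, ?_⟩,
    fun h => ⟨Superspace.rho_ncMonomial_eq_zero I h, ?_, ?_, ?_⟩⟩
  · refine (Superspace.powerData.eq_smul I h _ (Superspace.coeff_rho_ncPower _)).trans ?_
    have h1 : (∏ i, Superspace.powerData.s ((I.type h).anti i)) *
        ((I.type h).sym.map Superspace.powerData.s).prod = 1 := by
      simp [Superspace.powerData]
    rw [h1, mul_one]
    rfl
  · refine (Superspace.elementaryData.eq_smul I h _ (Superspace.coeff_rho_ncElementary _)).trans ?_
    rw [← Superspace.prod_factorial_eq]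
    rfl
  · refine (Superspace.homogeneousData.eq_smul I h _
      (Superspace.coeff_rho_ncHomogeneous _)).trans ?_
    rw [← Superspace.prod_factorial_eq]
    rfl
  · exact Superspace.powerData.eq_zero I h _ (Superspace.coeff_rho_ncPower _)
  · exact Superspace.elementaryData.eq_zero I h _ (Superspace.coeff_rho_ncElementary _)
  · exact Superspace.homogeneousData.eq_zero I h _ (Superspace.coeff_rho_ncHomogeneous _)
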